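/- **Setting.** A finite MDP $M=\langle\mathcal S,\mathcal A,P,c,s_0\rangle$ has a finite state space $\mathcal S$, a finite action space $\mathcal A$ with a distinguished action RESET, transition probabilities $P(s'\mid s,a)$, an initial state $s_0$, and, for every $(s,a)$, a distribution on $[c_{\min},1]$, with mean $c(s,a)$, from which the cost of taking $a$ in $s$ is drawn independently at each step. It is required that $P(s_0\mid s,\mathrm{RESET})=1$ for all $s$ and that RESET costs a constant $c_{\mathrm{RESET}}\in[c_{\min},1]$ in every state. A Markov policy $\pi$ assigns to each state and time a probability distribution over actions; $V^\pi_g(s)\in[0,\infty]$ is the expected total cost incurred until $g$ is first visited when starting in $s$ and following $\pi$. A deterministic stationary policy $\pi:\mathcal S\to\mathcal A$ is restricted on $\mathcal K\subseteq\mathcal S$ if $\pi(s)=\mathrm{RESET}$ for all $s\notin\mathcal K$. For a (strict) partial order $\prec$ on $\mathcal S$, let $\mathcal S_L^{\prec}$ be the smallest set that contains $s_0$ and contains every $s$ for which some deterministic stationary policy $\pi$ restricted on $\{s'\in\mathcal S_L^\prec: s'\prec s\}$ has $V^\pi_s(s_0)\le L$; let $\mathcal S_L^{\rightarrow}(M)=\bigcup_\prec\mathcal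 S_L^\prec$. Given real numbers $L,c_{\min}$ and positive integers $S,A,S_L$, let $\mathfrak M(L,S_L)$ be the class of all such MDPs with $|\mathcal S|\le S$, $|\mathcal A|\le A$ and $|\mathcal S_L^\rightarrow(M)|\le S_L$. An algorithm $(\boldsymbol\pi,\tau,\mathcal K,\{\pi_s\}_{s\in\mathcal K})$ knows $\mathcal S$, $\mathcal A$, $s_0$, RESET and the parameters below (in particular $c_{\min}$), but not $P$ or the cost distributions. It consists of a randomized history-dependent policy $\boldsymbol\pi$ (the history being the past states, actions and observed costs), a stopping time $\tau$ with respect to the history (the total number of steps taken), and, determined by the history at time $\tau$, a set $\mathcal K\subseteq\mathcal S$ and Markov policies $\{\pi_s\}_{s\in\mathcal K}$. It is $(\varepsilon,\delta,L)$-PAC for autonomous exploration (AX) on $M$ if, with probability at least $1-\delta$, it stops, $\mathcal K\supseteq\mathcal S_L^\rightarrow(M)$, and $V^{\pi_s}_s(s_0)\le(1+\varepsilon)L$ for all $s\in\mathcal S_L^\rightarrow(M)$. **Theorem 3 (minimax lower bound for AX).** There is an absolute constant $C>0$ such that the following holds. Let $L>4$ be real, let $S>8$, $A>4$ and $4\le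 S_L\le\min\{(A-1)^{\lfloor L/2\rfloor},S\}$ be integers, and let $0<\varepsilon<\tfrac14$, $0<\delta<\tfrac1{16}$, $0<c_{\min}\le1$. Then for any algorithm that is $(\varepsilon,\delta,L)$-PAC for AX on every MDP $M\in\mathfrak M(L,S_L)$ there is an MDP $\mathcal M\in\mathfrak M(L,S_L)$ such that $$\mathbb E_{\boldsymbol\pi,\mathcal M}[\tau]\ \ge\ C\,\frac{L\,S_L\,A}{c_{\min}\,\varepsilon^2}\log\frac1\delta ,$$ and, on the same $\mathcal M$, the cumulative cost $C_\tau=\sum_{t=1}^{\tau}c_t$ satisfies $$\mathbb E_{\boldsymbol\pi,\mathcal M}[C_\tau]\ \ge\ C\,\frac{L\,S_L\,A}{\varepsilon^{2}}\log\frac1\delta .$$ -/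

import Mathlib

open MeasureTheory ProbabilityTheory
open scoped ENNReal

noncomputable section

namespace AX

/-! ### Markov decision processes -/

/-- A finite Markov decision process `⟨S, A, P, c, s₀⟩` with random costs and a distinguished action
`reset`. Taking action `a` in state `s` moves to a state drawn from `P s a` and, independently,
incurs a cost drawn from `cost s a`. -/
structure MDP (S A : Type) [Fintype S] where
  /-- transition probabilities `P(s' | s, a)` -/
  P : S → A → stdSimplex ℝ S
  /-- distribution of the cost of taking an action in a state -/
  cost : S → A → Measure ℝ
  cost_prob : ∀ s a, IsProbabilityMeasure (cost s a)
  /-- initial state -/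
  s₀ : S
  /-- the action called RESET -/
  reset : A

/-- What is observed in one step: the current state, the action taken there, the cost incurred. -/
abbrev Step (S A : Type) : Type := S × A × ℝ

/-- Histories after `t` completed steps: the `t` steps, followed by the current state. -/
abbrev Hist (S A : Type) (t : ℕ) : Type := (Fin t → Step S A) × S

/-- The history after `t` completed steps along an infinite trajectory. -/
def histOf {S A : Type} (t : ℕ) (ω : ℕ → Step S A) : Hist S A t :=
  (fun i => ω i, (ω t).1)

/-- A randomized, history-dependent policy: a (measurable) choice of a probability distribution over
the actions after every history. -/
structure HistPolicy (S A : Type) [MeasurableSpace S] [MeasurableSpace A] [Fintype A] where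
  act : (t : ℕ) → Hist S A t → stdSimplex ℝ A
  measurable_act : ∀ t, Measurable (act t)

/-- A Markov policy: `π t s` is the distribution of the action taken in state `s` at time `t`
(times are counted from `0`). -/
abbrev MarkovPolicy (S A : Type) [Fintype A] : Type := ℕ → S → stdSimplex ℝ A

section

variable {S A : Type} [Fintype S] [Fintype A] [MeasurableSpace S] [MeasurableSpace A]

/-- A Markov policy, as a policy that ignores the past. -/
def MarkovPolicy.toHist [DiscreteMeasurableSpace S] (π : MarkovPolicy S A) : HistPolicy S A where
  act t h := π t h.2
  measurable_act t := (Measurable.of_discrete (f := π t)).comp measurable_snd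

open Classical in
/-- A deterministic stationary policy, as a Markov policy. -/
def detPolicy (π : S → A) : MarkovPolicy S A :=
  fun _ s => ⟨Pi.single (π s) 1, single_mem_stdSimplex ℝ (π s)⟩

namespace MDP

/-- Law of one step `(s, a, c)` from state `s`, when the action is drawn from `p`. -/
def stepLaw (M : MDP S A) (s : S) (p : stdSimplex ℝ A) : Measure (Step S A) :=
  ∑ a, ENNReal.ofReal (p a) • (M.cost s a).map (fun c => (s, a, c))

lemma sum_ofReal {X : Type} [Fintype X] (p : stdSimplex ℝ X) :
    ∑ x, ENNReal.ofReal (p x) = 1 := by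
  have h : ∑ x, p x = 1 := p.2.2
  rw [← ENNReal.ofReal_one, ← h]
  exact (ENNReal.ofReal_sum_of_nonneg (fun x _ => p.2.1 x)).symm

instance (M : MDP S A) (s : S) (p : stdSimplex ℝ A) : IsProbabilityMeasure (M.stepLaw s p) := by
  constructor
  have h : ∀ a, (M.cost s a).map (fun c => (s, a, c)) Set.univ = 1 := fun a => by
    have := M.cost_prob s a
    rw [Measure.map_apply (by fun_prop) MeasurableSet.univ]
    simp
  simp [stepLaw, h, sum_ofReal]

/-- Law of the next step given the steps `0, …, n` so far: the next state is drawn from the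
transition probabilities at the last state-action pair, the action from the policy, and the cost from
the cost distribution. -/
def nextLaw (M : MDP S A) (π : HistPolicy S A) (n : ℕ) (h : Finset.Iic n → Step S A) :
    Measure (Step S A) :=
  ∑ s', ENNReal.ofReal (M.P (h ⟨n, by simp⟩).1 (h ⟨n, by simp⟩).2.1 s') •
    M.stepLaw s' (π.act (n + 1) (fun i => h ⟨i, by simpa using Nat.lt_succ_iff.1 i.2⟩, s'))

lemma measurable_nextLaw [DiscreteMeasurableSpace S] [DiscreteMeasurableSpace A]
    (M : MDP S A) (π : HistPolicy S A) (n : ℕ) : Measurable (M.nextLaw π n) := by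
  refine Measure.measurable_of_measurable_coe _ fun B _ => ?_
  simp only [nextLaw, stepLaw, Measure.coe_finsetSum, Finset.sum_apply, Measure.smul_apply,
    smul_eq_mul]
  refine Finset.measurable_sum _ fun s' _ => Measurable.mul ?_ ?_
  · have h1 : Measurable fun x : S × A => ENNReal.ofReal (M.P x.1 x.2 s') := Measurable.of_discrete
    exact h1.comp (g := fun x : S × A => ENNReal.ofReal (M.P x.1 x.2 s'))
      (f := fun h : Finset.Iic n → Step S A => ((h ⟨n, by simp⟩).1, (h ⟨n, by simp⟩).2.1))
      (by fun_prop)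
  · refine Finset.measurable_sum _ fun a _ => Measurable.mul_const ?_ _
    refine ENNReal.measurable_ofReal.comp ?_
    have h2 : Measurable fun p : stdSimplex ℝ A => p a :=
      (measurable_pi_apply a).comp measurable_subtype_coe
    exact h2.comp ((π.measurable_act (n + 1)).comp (by fun_prop))

/-- The transition kernel of the trajectory. -/
def nextKernel [DiscreteMeasurableSpace S] [DiscreteMeasurableSpace A]
    (M : MDP S A) (π : HistPolicy S A) (n : ℕ) :
    Kernel (Finset.Iic n → Step S A) (Step S A) where
  toFun := M.nextLaw π n
  measurable' := M.measurable_nextLaw π n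

instance [DiscreteMeasurableSpace S] [DiscreteMeasurableSpace A]
    (M : MDP S A) (π : HistPolicy S A) (n : ℕ) : IsMarkovKernel (M.nextKernel π n) := by
  refine ⟨fun h => ⟨?_⟩⟩
  change M.nextLaw π n h Set.univ = 1
  simp [nextLaw, sum_ofReal]

variable [DiscreteMeasurableSpace S] [DiscreteMeasurableSpace A]

/-- The law of the whole trajectory `(s_t, a_t, c_t)_{t ≥ 0}` when the policy `π` interacts with the
MDP `M` from the starting state `s`. -/
def law (M : MDP S A) (π : HistPolicy S A) (s : S) : Measure (ℕ → Step S A) :=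
  Kernel.trajMeasure (X := fun _ => Step S A)
    (M.stepLaw s (π.act 0 (fun i => i.elim0, s))) (M.nextKernel π)

instance (M : MDP S A) (π : HistPolicy S A) (s : S) : IsProbabilityMeasure (M.law π s) := by
  unfold law
  infer_instance

open Classical in
/-- `V_g^π(s)`: the expected total cost until the goal `g` is reached from `s` under a Markov
policy `π`, as an extended nonnegative real (the step at time `t` is paid for as long as `g` has not
been visited up to time `t`). -/
def value (M : MDP S A) (π : MarkovPolicy S A) (g s : S) : ℝ≥0∞ :=
  ∫⁻ ω, ∑' t, (if ∀ i ≤ t, (ω i).1 ≠ g then ENNReal.ofReal (ω t).2.2 else 0) ∂(M.law π.toHist s)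

/-- A deterministic stationary policy is restricted on `K` if it takes RESET outside `K`. -/
def RestrictedOn (M : MDP S A) (π : S → A) (K : Set S) : Prop :=
  ∀ s ∉ K, π s = M.reset

/-- `X` contains `s₀`, and every `s` for which some policy restricted on `{s' ∈ X | s' ≺ s}` reaches
`s` from `s₀` with expected cost at most `L`. -/
def IsClosedUnderReach (M : MDP S A) (L : ℝ) (prec : S → S → Prop) (X : Set S) : Prop :=
  M.s₀ ∈ X ∧ ∀ s, (∃ π : S → A, M.RestrictedOn π {s' | s' ∈ X ∧ prec s' s} ∧
    M.value (detPolicy π) s M.s₀ ≤ ENNReal.ofReal L) → s ∈ X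

/-- `S_L^≺`: the set generated by these two rules, i.e. the smallest such set. -/
def reachable (M : MDP S A) (L : ℝ) (prec : S → S → Prop) : Set S :=
  ⋂₀ {X | M.IsClosedUnderReach L prec X}

/-- `S_L^→`: the incrementally `L`-controllable states, the union of the sets `S_L^≺` over all
(strict) partial orders `≺`. -/
def controllable (M : MDP S A) (L : ℝ) : Set S :=
  {s | ∃ prec : S → S → Prop, IsStrictOrder S prec ∧ s ∈ M.reachable L prec}

/-- RESET leads to `s₀` from everywhere, at a constant deterministic cost in `[cmin, 1]`. -/
def ResetAssumption (M : MDP S A) (cmin : ℝ) : Prop :=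
  (∀ s, M.P s M.reset M.s₀ = 1) ∧
    ∃ cR ∈ Set.Icc cmin 1, ∀ s, M.cost s M.reset = Measure.dirac cR

/-- The class `𝔐(L, S_L)` of MDPs, with at most `Smax` states, at most `Amax` actions, costs in
`[cmin, 1]`, the RESET property, and at most `SL` incrementally `L`-controllable states. -/
def InClass (M : MDP S A) (Smax Amax : ℕ) (cmin L : ℝ) (SL : ℕ) : Prop :=
  Fintype.card S ≤ Smax ∧ Fintype.card A ≤ Amax ∧
    (∀ s a, M.cost s a (Set.Icc cmin 1) = 1) ∧
    M.ResetAssumption cmin ∧ (M.controllable L).ncard ≤ SL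

end MDP

/-! ### Learning algorithms -/

/-- A learning algorithm `(𝛑, τ, K, (π_g)_g)`: a history-dependent policy, a rule deciding from the
history whether to stop, and the output as a function of the history at the stopping time, which
consists of a set `K` of states and of a Markov policy for every goal in `K` (the value of `output`
at goals outside `K` is irrelevant). -/
structure Algorithm (S A : Type) [Fintype A] [MeasurableSpace S] [MeasurableSpace A] where
  policy : HistPolicy S A
  /-- the histories after which the algorithm stops -/
  halts : (t : ℕ) → Set (Hist S A t)
  measurableSet_halts : ∀ t, MeasurableSet (halts t)
  known : (t : ℕ) → Hist S A t → Set S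
  measurable_known : ∀ t, Measurable (known t)
  output : (t : ℕ) → Hist S A t → S → MarkovPolicy S A
  measurable_output : ∀ t, Measurable (output t)

namespace Algorithm

variable [DiscreteMeasurableSpace S] [DiscreteMeasurableSpace A]

/-- The stopping time `τ`: the number of steps taken before the algorithm stops (`⊤` if never). -/
def τ (𝔞 : Algorithm S A) (ω : ℕ → Step S A) : ℕ∞ :=
  ⨅ (t : ℕ) (_ : histOf t ω ∈ 𝔞.halts t), (t : ℕ∞)

/-- The output `K`, `(π_g)` is correct for autonomous exploration with radius `L` and error `ε`. -/
def GoodOutput (M : MDP S A) (ε L : ℝ) (K : Set S) (π : S → MarkovPolicy S A) : Prop :=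
  M.controllable L ⊆ K ∧
    ∀ s ∈ M.controllable L, M.value (π s) s M.s₀ ≤ ENNReal.ofReal ((1 + ε) * L)

/-- `(ε, δ, L)`-PAC on `M`: with probability at least `1 - δ`, the algorithm stops with a correct
output. -/
def IsPAC (𝔞 : Algorithm S A) (M : MDP S A) (ε δ L : ℝ) : Prop :=
  ENNReal.ofReal (1 - δ) ≤ M.law 𝔞.policy M.s₀
    {ω | ∃ t : ℕ, 𝔞.τ ω = t ∧
      GoodOutput M ε L (𝔞.known t (histOf t ω)) (𝔞.output t (histOf t ω))}

/-- The expected stopping time `E_{𝛑, M}[τ]`. -/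
def expectedTime (𝔞 : Algorithm S A) (M : MDP S A) : ℝ≥0∞ :=
  ∫⁻ ω, ((𝔞.τ ω : ℕ∞) : ℝ≥0∞) ∂(M.law 𝔞.policy M.s₀)

open Classical in
/-- The expected cumulative cost of all the steps taken until the algorithm stops. -/
def expectedCost (𝔞 : Algorithm S A) (M : MDP S A) : ℝ≥0∞ :=
  ∫⁻ ω, ∑' t : ℕ, (if (t : ℕ∞) < 𝔞.τ ω then ENNReal.ofReal (ω t).2.2 else 0)
    ∂(M.law 𝔞.policy M.s₀)

end Algorithm

end

end AX

end

open AX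

set_option linter.unusedSectionVars false

noncomputable section

namespace AX

section

variable {S A : Type} [Fintype S] [Fintype A] [MeasurableSpace S] [MeasurableSpace A]

/-! The hard instances are a tree with a hidden good exit. Put `b = A - 1` and `n = S_L - 1`. The
`n` nodes form a `b`-ary tree rooted at `s₀`, and one more state is the goal. Every step costs `c =
c_min`, and non-reset actions lead deterministically to children. The pairs (node, action) that have
no child are the arms: each moves to the goal with a small probability and otherwise stays put.
Write `Λ = L / c`. In the base instance an arm at depth `d` succeeds with probability `1 / (Λ (1 +
3ε) - d)`, so every arm gives expected hitting time `Λ (1 + 3ε)`. In the instance planted at `w`,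
the arm `w` succeeds with probability `1 / (Λ - d)`, so the goal is reached at expected cost exactly
`L` and is incrementally controllable. Depths are at most `L / 2 ≤ Λ / 2`, which makes all success
probabilities of order `1 / Λ`. All instances have `S_L` states in total, so they belong to the
class.

A potential argument (`exists_occ_of_value_le`) shows that a policy with value at most `(1 + ε) L`
on the instance planted at `w` must, in the base instance, enter the goal through `w` with
probability at least `1/4`. Hence one output policy can be good for at most four plantings
(`card_le_of_value_le`). Under the base law, the probabilities of being good for `w` therefore sum
to at most 4 over the arms, and all but 8 arms have probability at most `1/2`.

For such an arm `w`, the event that the algorithm stops with a policy bad for `w` is likely under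
the base law, but has probability at most `δ` under the planted law by the PAC property. The two
laws differ only at `w`, where the divergence of one transition is at most `144 ε² / Λ`
(`sum_log_plantedRatio_le`). A change of measure up to the stopping time (`log_le_sum_visits`) then
forces of order `(Λ / ε²) log (1/δ)` expected pulls of `w` in the base instance. There are at least
`n (b - 1) + 1` arms (`le_card_arms`) and each step pulls at most one of them, so summing gives the
bound on `E[τ]` for the base instance. Multiplying by the constant cost `c` gives the bound on the
cumulative cost. -/

/-- The trajectory that follows `ω` up to time `n` and is constantly `y` afterwards. -/
def glue {X : Type} (n : ℕ) (ω : ℕ → X) (y : X) : ℕ → X := fun i => if i ≤ n then ω i else y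

lemma glue_of_le {X : Type} {n i : ℕ} (ω : ℕ → X) (y : X) (h : i ≤ n) : glue n ω y i = ω i :=
  if_pos h

lemma glue_succ {X : Type} (n : ℕ) (ω : ℕ → X) (y : X) : glue n ω y (n + 1) = y :=
  if_neg (by omega)

lemma measurable_glue {X : Type} [MeasurableSpace X] (n : ℕ) :
    Measurable fun p : (ℕ → X) × X => glue n p.1 p.2 := by
  refine measurable_pi_lambda _ fun i => ?_
  unfold glue
  split_ifs <;> fun_prop

lemma measurable_histOf (t : ℕ) : Measurable (histOf t : (ℕ → Step S A) → Hist S A t) := by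
  unfold histOf
  fun_prop

lemma histOf_dependsOn (t : ℕ) :
    DependsOn (histOf t : (ℕ → Step S A) → Hist S A t) (Set.Iic t) := by
  intro ω ω' h
  unfold histOf
  rw [h t (by simp)]
  congr 1
  funext i
  exact h i i.2.le

/-! ### One-step disintegration of the trajectory law -/

namespace MDP

variable (M : MDP S A) (π : HistPolicy S A)

lemma lintegral_stepLaw (s : S) (p : stdSimplex ℝ A) {F : Step S A → ℝ≥0∞} (hF : Measurable F) :
    ∫⁻ y, F y ∂(M.stepLaw s p) =
      ∑ a, ENNReal.ofReal (p a) * ∫⁻ c, F (s, a, c) ∂(M.cost s a) := by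
  simp only [stepLaw, lintegral_finsetSum_measure, lintegral_smul_measure, smul_eq_mul]
  refine Finset.sum_congr rfl fun a _ => ?_
  rw [lintegral_map hF (by fun_prop)]

/-- The law of the step after time `n`, along a trajectory. -/
abbrev nextAlong (n : ℕ) (ω : ℕ → Step S A) : Measure (Step S A) :=
  M.nextLaw π n (Preorder.frestrictLe n ω)

lemma lintegral_nextAlong (n : ℕ) (ω : ℕ → Step S A) {F : Step S A → ℝ≥0∞} (hF : Measurable F) :
    ∫⁻ y, F y ∂(M.nextAlong π n ω) =
      ∑ s', ENNReal.ofReal (M.P (ω n).1 (ω n).2.1 s') *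
        ∑ a, ENNReal.ofReal (π.act (n + 1) (fun i => ω i, s') a) *
          ∫⁻ c, F (s', a, c) ∂(M.cost s' a) := by
  simp only [nextAlong, nextLaw, lintegral_finsetSum_measure, lintegral_smul_measure, smul_eq_mul,
    lintegral_stepLaw M _ _ hF]
  rfl

variable [DiscreteMeasurableSpace S] [DiscreteMeasurableSpace A]

instance (n : ℕ) (ω : ℕ → Step S A) : IsProbabilityMeasure (M.nextAlong π n ω) :=
  inferInstanceAs (IsProbabilityMeasure (M.nextKernel π n (Preorder.frestrictLe n ω)))

lemma measurable_lintegral_nextAlong (n : ℕ) {F : (ℕ → Step S A) × Step S A → ℝ≥0∞}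
    (hF : Measurable F) : Measurable fun ω => ∫⁻ y, F (ω, y) ∂(M.nextAlong π n ω) := by
  have h := Measurable.lintegral_kernel_prod_right
    (κ := (M.nextKernel π n).comap (Preorder.frestrictLe n) (by fun_prop))
    (f := fun ω y => F (ω, y)) hF
  exact h

/-- Disintegration of the law of the trajectory along the step at time `n + 1`. -/
lemma lintegral_law_succ (s : S) (n : ℕ) {F : (ℕ → Step S A) → ℝ≥0∞} (hF : Measurable F)
    (hd : DependsOn F (Set.Iic (n + 1))) :
    ∫⁻ ω, F ω ∂(M.law π s) =
      ∫⁻ ω, ∫⁻ y, F (glue n ω y) ∂(M.nextAlong π n ω) ∂(M.law π s) := by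
  -- This is `glue` expressed on finite prefixes, because the identity `key` for the trajectory
  -- measure is stated for the restriction to times at most `n`.
  let ext : (Finset.Iic n → Step S A) × Step S A → ℕ → Step S A :=
    fun p i => if h : i ≤ n then p.1 ⟨i, by simpa using h⟩ else p.2
  have hext : Measurable ext := by
    refine measurable_pi_lambda _ fun i => ?_
    by_cases h : i ≤ n
    · simp only [ext, h, dite_true]; fun_prop
    · simp only [ext, h, dite_false]; fun_prop
  have hFe : Measurable fun p => F (ext p) := hF.comp hext
  have hglue : ∀ ω y, ext (Preorder.frestrictLe n ω, y) = glue n ω y := by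
    intro ω y
    funext i
    by_cases h : i ≤ n <;> simp [ext, glue, h]
  have key := Kernel.map_frestrictLe_trajMeasure_compProd_eq_map_trajMeasure
    (X := fun _ => Step S A) (μ₀ := M.stepLaw s (π.act 0 (fun i => i.elim0, s)))
    (κ := M.nextKernel π) (a := n)
  have h1 : ∫⁻ p, F (ext p) ∂((M.law π s).map
      (fun x => (Preorder.frestrictLe (π := fun _ => Step S A) n x, x (n + 1)))) =
      ∫⁻ ω, F ω ∂(M.law π s) := by
    rw [lintegral_map hFe (by fun_prop)]
    refine lintegral_congr fun ω => ?_
    rw [hglue]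
    refine hd fun i hi => ?_
    rcases Nat.lt_or_ge n i with h | h
    · obtain rfl : i = n + 1 := le_antisymm hi h
      exact glue_succ _ _ _
    · exact glue_of_le _ _ h
  rw [← h1]
  change ∫⁻ p, F (ext p) ∂((Kernel.trajMeasure (X := fun _ => Step S A) _ (M.nextKernel π)).map _)
    = _
  rw [← key, Measure.lintegral_compProd hFe,
    lintegral_map hFe.lintegral_kernel_prod_right' (by fun_prop)]
  refine lintegral_congr fun ω => lintegral_congr fun y => ?_
  rw [hglue]

lemma map_law_zero (s : S) :
    (M.law π s).map (fun ω => ω 0) = M.stepLaw s (π.act 0 (fun i => i.elim0, s)) := by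
  have h0 : (fun ω : ℕ → Step S A => ω 0) =
      (MeasurableEquiv.piUnique (fun _ : Finset.Iic 0 => Step S A)) ∘
        (Preorder.frestrictLe (π := fun _ => Step S A) 0) := by
    funext ω; rfl
  rw [h0, ← Measure.map_map (by fun_prop) (by fun_prop), law, Kernel.trajMeasure,
    Measure.map_comp _ _ (by fun_prop), Kernel.traj_map_frestrictLe, Kernel.partialTraj_self,
    Measure.id_comp, Measure.map_map (by fun_prop) (by fun_prop)]
  convert Measure.map_id
  funext x
  exact (MeasurableEquiv.piUnique (fun _ : Finset.Iic 0 => Step S A)).apply_symm_apply x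

lemma lintegral_law_zero (s : S) {F : (ℕ → Step S A) → ℝ≥0∞} (hF : Measurable F)
    (hd : DependsOn F (Set.Iic 0)) :
    ∫⁻ ω, F ω ∂(M.law π s) =
      ∫⁻ y, F (fun _ => y) ∂(M.stepLaw s (π.act 0 (fun i => i.elim0, s))) := by
  have hF' : Measurable fun y : Step S A => F fun _ => y := hF.comp (by fun_prop)
  rw [← M.map_law_zero π s, lintegral_map hF' (by fun_prop)]
  refine lintegral_congr fun ω => hd fun i hi => ?_
  obtain rfl : i = 0 := by simpa using hi
  rfl

/-- If all costs equal `c`, then almost surely only the cost `c` is observed. -/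
lemma ae_cost_eq {c : ℝ} (hc : ∀ s a, M.cost s a = Measure.dirac c) (s : S) :
    ∀ᵐ ω ∂(M.law π s), ∀ t, (ω t).2.2 = c := by
  classical
  have hm : MeasurableSet {y : Step S A | y.2.2 = c} :=
    measurableSet_eq_fun (by fun_prop) (by fun_prop)
  let G : Step S A → ℝ≥0∞ := fun y => if y.2.2 = c then 0 else 1
  have hG : Measurable G := Measurable.ite hm measurable_const measurable_const
  rw [ae_all_iff]
  intro t
  have hGt : Measurable fun ω : ℕ → Step S A => G (ω t) := hG.comp (by fun_prop)
  have hd : DependsOn (fun ω : ℕ → Step S A => G (ω t)) (Set.Iic t) := by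
    intro ω ω' h
    simp only [h t (by simp)]
  suffices h : ∫⁻ ω, G (ω t) ∂(M.law π s) = 0 by
    rw [lintegral_eq_zero_iff hGt] at h
    filter_upwards [h] with ω hω
    by_contra hne
    simp [G, hne] at hω
  have hGc : ∀ x a, ∫⁻ r, G (x, a, r) ∂(M.cost x a) = 0 := by
    intro x a
    rw [hc, lintegral_dirac]
    simp [G]
  cases t with
  | zero =>
    rw [M.lintegral_law_zero π s hGt hd, M.lintegral_stepLaw _ _ hG]
    simp [hGc]
  | succ t =>
    rw [M.lintegral_law_succ π s t hGt hd]
    refine (lintegral_congr fun ω => ?_).trans lintegral_zero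
    simp only [glue_succ]
    rw [M.lintegral_nextAlong π t ω hG]
    simp [hGc]

end MDP

end

/-! ### Occupancies and hitting times of Markov policies -/

namespace MDP

section

variable {S A : Type} [Fintype S] [Fintype A]

open Classical in
/-- The probability of being in state `z.1` and taking action `z.2` at time `t`, without having
visited `g` so far, when following the Markov policy `π` from `s`. -/
def occ (M : MDP S A) (π : MarkovPolicy S A) (g s : S) : ℕ → S × A → ℝ
  | 0, z => if z.1 = s ∧ z.1 ≠ g then π 0 z.1 z.2 else 0
  | t + 1, z => if z.1 = g then 0 else
      (∑ w, occ M π g s t w * M.P w.1 w.2 z.1) * π (t + 1) z.1 z.2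

variable (M : MDP S A) (π : MarkovPolicy S A) (g s : S)

lemma occ_nonneg (t : ℕ) (z : S × A) : 0 ≤ M.occ π g s t z := by
  induction t generalizing z with
  | zero =>
    rw [occ]
    split_ifs
    · exact (π 0 z.1).2.1 _
    · exact le_rfl
  | succ t ih =>
    rw [occ]
    split_ifs
    · exact le_rfl
    · exact mul_nonneg (Finset.sum_nonneg fun w _ => mul_nonneg (ih w) ((M.P _ _).2.1 _))
        ((π (t + 1) z.1).2.1 _)

lemma occ_goal (t : ℕ) (a : A) : M.occ π g s t (g, a) = 0 := by
  cases t <;> simp [occ]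

lemma occ_eq_zero_of_policy {t : ℕ} {z : S × A} (h : π t z.1 z.2 = 0) : M.occ π g s t z = 0 := by
  cases t <;> simp [occ, h]

lemma sum_occ_zero {ψ : S → ℝ} (hψ : ψ g = 0) :
    ∑ z, M.occ π g s 0 z * ψ z.1 = ψ s := by
  classical
  rw [Fintype.sum_prod_type, Finset.sum_eq_single s]
  · simp only [occ, true_and]
    by_cases h : s = g
    · simp [h, hψ]
    · simp only [ne_eq, h, not_false_eq_true, if_true]
      rw [← Finset.sum_mul, show ∑ a, π 0 s a = 1 from (π 0 s).2.2, one_mul]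
  · intro x _ hx
    simp [occ, hx]
  · simp

/-- One step of the forward recursion is the adjoint of applying the transition operator to `ψ`.
Mass entering `g` is killed in `occ`, which is harmless because `ψ` vanishes there. -/
lemma sum_occ_succ (t : ℕ) {ψ : S → ℝ} (hψ : ψ g = 0) :
    ∑ z, M.occ π g s (t + 1) z * ψ z.1 =
      ∑ z, M.occ π g s t z * ∑ x, M.P z.1 z.2 x * ψ x := by
  classical
  have h1 : ∀ x : S, ∑ a, M.occ π g s (t + 1) (x, a) * ψ x =
      (∑ w, M.occ π g s t w * M.P w.1 w.2 x) * ψ x := by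
    intro x
    by_cases h : x = g
    · simp [h, hψ]
    · simp only [occ, h, if_false]
      rw [← Finset.sum_mul, ← Finset.mul_sum, show ∑ a, π (t + 1) x a = 1 from (π (t + 1) x).2.2,
        mul_one]
  rw [Fintype.sum_prod_type]
  simp only [h1, Finset.sum_mul, Finset.mul_sum]
  rw [Finset.sum_comm]
  simp only [mul_assoc]

/-- Upper bound on the expected hitting time by a potential. -/
lemma sum_occ_le_of_potential {ψ : S → ℝ} (hψ : ψ g = 0) (h0 : ∀ x, 0 ≤ ψ x)
    (h : ∀ t z, z.1 ≠ g → M.occ π g s t z ≠ 0 → 1 + ∑ x, M.P z.1 z.2 x * ψ x ≤ ψ z.1) (T : ℕ) :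
    ∑ t ∈ Finset.range T, ∑ z, M.occ π g s t z ≤ ψ s := by
  -- The time spent up to `T` plus the potential of the surviving mass does not increase with `T`.
  suffices h : ∑ t ∈ Finset.range T, ∑ z, M.occ π g s t z + ∑ z, M.occ π g s T z * ψ z.1 ≤ ψ s from
    le_trans (le_add_of_nonneg_right (Finset.sum_nonneg fun z _ =>
      mul_nonneg (M.occ_nonneg π g s T z) (h0 _))) h
  induction T with
  | zero => simp [sum_occ_zero M π g s hψ]
  | succ T ih =>
    refine le_trans ?_ ih
    rw [Finset.sum_range_succ, sum_occ_succ M π g s T hψ, add_assoc, ← Finset.sum_add_distrib]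
    gcongr with z
    by_cases hz : M.occ π g s T z = 0
    · simp [hz]
    · have hg : z.1 ≠ g := by
        rintro rfl
        exact hz (M.occ_goal π _ s T z.2)
      have := mul_le_mul_of_nonneg_left (h T z hg hz) (M.occ_nonneg π g s T z)
      linarith

/-- Lower bound on the expected hitting time by a potential, up to the correction `d`. -/
lemma le_sum_occ_of_potential {ψ : S → ℝ} {d : S × A → ℝ} (hψ : ψ g = 0)
    (h : ∀ z : S × A, z.1 ≠ g → ψ z.1 ≤ 1 + ∑ x, M.P z.1 z.2 x * ψ x + d z) (T : ℕ) :
    ψ s ≤ ∑ t ∈ Finset.range T, ∑ z, M.occ π g s t z +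
      ∑ t ∈ Finset.range T, ∑ z, M.occ π g s t z * d z + ∑ z, M.occ π g s T z * ψ z.1 := by
  induction T with
  | zero => simp [sum_occ_zero M π g s hψ]
  | succ T ih =>
    refine ih.trans ?_
    rw [Finset.sum_range_succ, Finset.sum_range_succ, sum_occ_succ M π g s T hψ]
    have : ∑ z, M.occ π g s T z * ψ z.1 ≤ ∑ z, M.occ π g s T z +
        ∑ z, M.occ π g s T z * d z + ∑ z, M.occ π g s T z * ∑ x, M.P z.1 z.2 x * ψ x := by
      rw [← Finset.sum_add_distrib, ← Finset.sum_add_distrib]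
      gcongr with z
      by_cases hg : z.1 = g
      · have : M.occ π g s T z = 0 := by
          have := M.occ_goal π g s T z.2
          rwa [show (g, z.2) = z from Prod.ext hg.symm rfl] at this
        simp [this]
      · have := mul_le_mul_of_nonneg_left (h z hg) (M.occ_nonneg π g s T z)
        linarith
    linarith

/-- The goal is hit at most once. -/
lemma sum_occ_mul_goal_le (T : ℕ) :
    ∑ t ∈ Finset.range T, ∑ z, M.occ π g s t z * M.P z.1 z.2 g ≤ 1 := by
  classical
  let ψ : S → ℝ := fun x => if x = g then 0 else 1
  have hψ : ψ g = 0 := by simp [ψ]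
  have hP : ∀ z : S × A, ∑ x, M.P z.1 z.2 x * ψ x = 1 - M.P z.1 z.2 g := by
    intro z
    have h1 : ∑ x, M.P z.1 z.2 x = 1 := (M.P z.1 z.2).2.2
    rw [← h1, ← Finset.sum_erase_eq_sub (Finset.mem_univ g), ← Finset.add_sum_erase _ _
      (Finset.mem_univ g)]
    simp only [hψ, mul_zero, zero_add]
    refine Finset.sum_congr rfl fun x hx => ?_
    simp [ψ, Finset.ne_of_mem_erase hx]
  have hocc : ∀ t, ∑ z, M.occ π g s t z * ψ z.1 = ∑ z, M.occ π g s t z := by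
    intro t
    refine Finset.sum_congr rfl fun z _ => ?_
    by_cases hg : z.1 = g
    · have := M.occ_goal π g s t z.2
      rw [show (g, z.2) = z from Prod.ext hg.symm rfl] at this
      simp [this]
    · simp [ψ, hg]
  -- Conservation of mass: what has entered the goal before time `T` plus what survives at time `T`
  -- equals the initial mass off the goal.
  suffices h : ∑ t ∈ Finset.range T, ∑ z, M.occ π g s t z * M.P z.1 z.2 g +
      ∑ z, M.occ π g s T z = ψ s by
    have h1 : ψ s ≤ 1 := by simp only [ψ]; split_ifs <;> norm_num
    have h2 : 0 ≤ ∑ z, M.occ π g s T z := Finset.sum_nonneg fun z _ => M.occ_nonneg π g s T z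
    linarith
  induction T with
  | zero => rw [← hocc, sum_occ_zero M π g s hψ]; simp
  | succ T ih =>
    rw [Finset.sum_range_succ, ← hocc (T + 1), sum_occ_succ M π g s T hψ, ← ih, add_assoc,
      ← Finset.sum_add_distrib]
    congr 1
    refine Finset.sum_congr rfl fun z _ => ?_
    rw [hP]
    ring

/-- Occupancies are monotone in the transition probabilities between states other than the goal. -/
lemma occ_mono {M M' : MDP S A} (hP : ∀ x a x', x' ≠ g → M'.P x a x' ≤ M.P x a x') (t : ℕ)
    (z : S × A) : M'.occ π g s t z ≤ M.occ π g s t z := by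
  induction t generalizing z with
  | zero => exact le_rfl
  | succ t ih =>
    rw [occ, occ]
    split_ifs with h
    · exact le_rfl
    · exact mul_le_mul_of_nonneg_right (Finset.sum_le_sum fun w _ =>
        mul_le_mul (ih w) (hP _ _ _ h) ((M'.P _ _).2.1 _) (M.occ_nonneg π g s t w))
        ((π (t + 1) z.1).2.1 _)

section Measurability

lemma measurable_occ (t : ℕ) (z : S × A) :
    Measurable fun π : MarkovPolicy S A => M.occ π g s t z := by
  have hπ : ∀ t x (a : A), Measurable fun π : MarkovPolicy S A => π t x a := fun t x a =>
    (measurable_pi_apply a).comp (measurable_subtype_coe.comp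
      ((measurable_pi_apply x).comp (measurable_pi_apply t)))
  induction t generalizing z with
  | zero =>
    simp only [occ]
    split_ifs
    · exact hπ _ _ _
    · exact measurable_const
  | succ t ih =>
    simp only [occ]
    split_ifs
    · exact measurable_const
    · exact (Finset.measurable_sum _ fun w _ => (ih w).mul_const _).mul (hπ _ _ _)

end Measurability

variable [MeasurableSpace S] [MeasurableSpace A] [DiscreteMeasurableSpace S]
  [DiscreteMeasurableSpace A]

/-- The trajectories that have not visited `g` up to time `t`, when they are at `z.1` and take the
action `z.2`. -/
def survive (g : S) (t : ℕ) (z : S × A) : Set (ℕ → Step S A) :=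
  {ω | (∀ i ≤ t, (ω i).1 ≠ g) ∧ ((ω t).1, (ω t).2.1) = z}

lemma measurableSet_unvisited (g : S) (t : ℕ) :
    MeasurableSet {ω : ℕ → Step S A | ∀ i ≤ t, (ω i).1 ≠ g} := by
  have : {ω : ℕ → Step S A | ∀ i ≤ t, (ω i).1 ≠ g} = ⋂ i, ⋂ (_ : i ≤ t), {ω | (ω i).1 ≠ g} := by
    ext; simp
  rw [this]
  exact MeasurableSet.iInter fun i => MeasurableSet.iInter fun _ =>
    (MeasurableSet.of_discrete (s := {x : S | x ≠ g})).preimage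
      (f := fun ω : ℕ → Step S A => (ω i).1) (by fun_prop)

lemma measurableSet_survive (g : S) (t : ℕ) (z : S × A) : MeasurableSet (survive g t z) :=
  (measurableSet_unvisited g t).inter
    ((MeasurableSet.of_discrete (s := {x : S × A | x = z})).preimage
      (f := fun ω : ℕ → Step S A => ((ω t).1, (ω t).2.1)) (by fun_prop))

lemma dependsOn_survive (g : S) (t : ℕ) (z : S × A) :
    DependsOn (fun ω => (survive g t z).indicator (1 : (ℕ → Step S A) → ℝ≥0∞) ω) (Set.Iic t) := by
  intro ω ω' h
  have h1 : ω ∈ survive g t z ↔ ω' ∈ survive g t z :=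
    and_congr (forall₂_congr fun i hi => by rw [h i hi]) (by rw [h t (by simp)])
  by_cases hω : ω ∈ survive g t z <;> simp [hω, ← h1]

/-- Induction on time by disintegration: the indicator of surviving to `t + 1` factors into the
indicator of surviving to `t` and a condition on the new step, which reproduces the recursion of
`occ`. -/
lemma law_survive (t : ℕ) (z : S × A) :
    M.law π.toHist s (survive g t z) = ENNReal.ofReal (M.occ π g s t z) := by
  classical
  have hm : ∀ t (z : S × A), Measurable fun ω : ℕ → Step S A =>
      (survive g t z).indicator (1 : (ℕ → Step S A) → ℝ≥0∞) ω := fun t z =>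
    measurable_one.indicator (measurableSet_survive g t z)
  let G : Step S A → ℝ≥0∞ := fun y => if (y.1, y.2.1) = z then 1 else 0
  have hG : Measurable G :=
    (Measurable.of_discrete (f := fun w : S × A => if w = z then (1 : ℝ≥0∞) else 0)).comp
      (f := fun ω : Step S A => (ω.1, ω.2.1)) (by fun_prop)
  rw [← lintegral_indicator_one (measurableSet_survive g t z)]
  obtain ⟨x, a⟩ := z
  cases t with
  | zero =>
    rw [M.lintegral_law_zero π.toHist s (hm 0 _) (dependsOn_survive g 0 _)]
    have h2 : ∀ y : Step S A, (survive g 0 (x, a)).indicator (1 : (ℕ → Step S A) → ℝ≥0∞) (fun _ => y) =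
        (if x ≠ g then 1 else 0) * G y := by
      rintro ⟨y, b, c⟩
      by_cases hx : y = x <;> by_cases hb : b = a <;> by_cases hg : x = g <;>
        simp_all [survive, Set.indicator_apply, G]
    simp only [h2]
    rw [lintegral_const_mul _ hG, M.lintegral_stepLaw _ _ hG]
    simp only [Prod.mk.injEq, G]
    rw [Finset.sum_eq_single a]
    · have := M.cost_prob s a
      by_cases hs : s = x
      · subst hs
        by_cases hg : s = g <;> simp [occ, hg, MarkovPolicy.toHist]
      · simp [occ, hs, Ne.symm hs]
    · intro b _ hb
      simp [hb]
    · simp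
  | succ t =>
    rw [M.lintegral_law_succ π.toHist s t (hm _ _) (dependsOn_survive g _ _)]
    have h2 : ∀ (ω : ℕ → Step S A) (y : Step S A),
        (survive g (t + 1) (x, a)).indicator (1 : (ℕ → Step S A) → ℝ≥0∞) (glue t ω y) =
        ((if x ≠ g then 1 else 0) *
          (survive g t ((ω t).1, (ω t).2.1)).indicator (1 : (ℕ → Step S A) → ℝ≥0∞) ω) * G y := by
      intro ω y
      have h3 : (∀ i ≤ t + 1, (glue t ω y i).1 ≠ g) ↔ (∀ i ≤ t, (ω i).1 ≠ g) ∧ y.1 ≠ g := by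
        constructor
        · intro h
          refine ⟨fun i hi => ?_, ?_⟩
          · have := h i (by omega)
            rwa [glue_of_le _ _ hi] at this
          · have := h (t + 1) le_rfl
            rwa [glue_succ] at this
        · rintro ⟨h, h'⟩ i hi
          rcases Nat.lt_or_ge t i with hti | hti
          · obtain rfl : i = t + 1 := by omega
            rwa [glue_succ]
          · rw [glue_of_le _ _ hti]
            exact h i hti
      have h5 : glue t ω y ∈ survive g (t + 1) (x, a) ↔
          ((∀ i ≤ t, (ω i).1 ≠ g) ∧ y.1 ≠ g) ∧ (y.1, y.2.1) = (x, a) := by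
        rw [← h3, survive, Set.mem_ofPred_eq, glue_succ]
      have h6 : ω ∈ survive g t ((ω t).1, (ω t).2.1) ↔ ∀ i ≤ t, (ω i).1 ≠ g :=
        and_iff_left rfl
      simp only [Set.indicator_apply, h5, h6, G]
      obtain ⟨y, b, c⟩ := y
      by_cases hA : (∀ i ≤ t, (ω i).1 ≠ g) <;>
      by_cases hx : y = x <;> by_cases hb : b = a <;> by_cases hg : x = g <;> simp_all
    simp only [h2]
    have h4 : ∀ ω : ℕ → Step S A, ∫⁻ y, ((if x ≠ g then 1 else 0) *
        (survive g t ((ω t).1, (ω t).2.1)).indicator (1 : (ℕ → Step S A) → ℝ≥0∞) ω) * G y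
          ∂(M.nextAlong π.toHist t ω) =
        ∑ w : S × A, (survive g t w).indicator (1 : (ℕ → Step S A) → ℝ≥0∞) ω *
          ((if x ≠ g then 1 else 0) * (ENNReal.ofReal (M.P w.1 w.2 x) *
            ENNReal.ofReal (π (t + 1) x a))) := by
      intro ω
      rw [lintegral_const_mul _ hG, M.lintegral_nextAlong _ _ _ hG]
      simp only [Prod.mk.injEq, G]
      rw [Finset.sum_eq_single x, Finset.sum_eq_single a,
        Finset.sum_eq_single ((ω t).1, (ω t).2.1)]
      · have := M.cost_prob x a
        simp only [and_self, if_true, lintegral_const, measure_univ, mul_one]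
        simp only [MarkovPolicy.toHist]
        ring
      · intro w _ hw
        have : ω ∉ survive g t w := fun h => hw h.2.symm
        simp [this]
      · simp
      · intro b _ hb
        simp [hb]
      · simp
      · intro y _ hy
        simp [hy]
      · simp
    simp only [h4]
    rw [lintegral_finsetSum _ fun w _ => (hm t w).mul_const _]
    simp only [lintegral_mul_const _ (hm t _)]
    have ih := fun w => law_survive t w
    simp only [lintegral_indicator_one (measurableSet_survive g t _), ih]
    by_cases hg : x = g
    · simp [occ, hg]
    · simp only [occ, hg, ne_eq, not_false_eq_true, if_true, one_mul, if_false]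
      have hn : ∀ w : S × A, 0 ≤ M.occ π g s t w * M.P w.1 w.2 x := fun w =>
        mul_nonneg (M.occ_nonneg π g s t w) ((M.P _ _).2.1 _)
      rw [ENNReal.ofReal_mul (Finset.sum_nonneg fun w _ => hn w),
        ENNReal.ofReal_sum_of_nonneg fun w _ => hn w, Finset.sum_mul]
      refine Finset.sum_congr rfl fun w _ => ?_
      rw [ENNReal.ofReal_mul (M.occ_nonneg π g s t w), mul_assoc]

/-- With constant costs, the value is the cost of one step times the expected hitting time. -/
lemma value_eq_tsum {c : ℝ} (hc : ∀ s a, M.cost s a = Measure.dirac c) :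
    M.value π g s = ∑' t, ENNReal.ofReal c * ENNReal.ofReal (∑ z, M.occ π g s t z) := by
  unfold value
  rw [lintegral_tsum fun t => (Measurable.ite (measurableSet_unvisited g t) (by fun_prop)
    measurable_const).aemeasurable]
  refine tsum_congr fun t => ?_
  have hm : ∀ z : S × A, Measurable ((survive g t z).indicator (1 : (ℕ → Step S A) → ℝ≥0∞)) :=
    fun z => measurable_one.indicator (measurableSet_survive g t z)
  refine (lintegral_congr_ae (g := fun ω => ∑ z : S × A, ENNReal.ofReal c *
    (survive g t z).indicator (1 : (ℕ → Step S A) → ℝ≥0∞) ω) ?_).trans ?_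
  · filter_upwards [M.ae_cost_eq π.toHist hc s] with ω hω
    rw [Finset.sum_eq_single ((ω t).1, (ω t).2.1)]
    · rw [hω]
      by_cases h : ∀ i ≤ t, (ω i).1 ≠ g
      · have h' : ω ∈ survive g t ((ω t).1, (ω t).2.1) := ⟨h, rfl⟩
        rw [if_pos h, Set.indicator_of_mem h']
        simp
      · have h' : ω ∉ survive g t ((ω t).1, (ω t).2.1) := fun h' => h h'.1
        rw [if_neg h, Set.indicator_of_notMem h']
        simp
    · intro w _ hw
      have : ω ∉ survive g t w := fun h => hw h.2.symm
      simp [this]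
    · simp
  rw [lintegral_finsetSum _ fun z _ => (hm z).const_mul _]
  simp only [lintegral_const_mul _ (hm _), lintegral_indicator_one (measurableSet_survive g t _)]
  rw [ENNReal.ofReal_sum_of_nonneg fun z _ => M.occ_nonneg π g s t z, Finset.mul_sum]
  refine Finset.sum_congr rfl fun z _ => ?_
  rw [← M.law_survive π g s t z]

/-- The policy output by an algorithm is random, so measurability in the policy is what makes "the
output is near-optimal" an event. -/
lemma measurable_value {c : ℝ} (hc : ∀ s a, M.cost s a = Measure.dirac c) :
    Measurable fun π : MarkovPolicy S A => M.value π g s := by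
  simp only [fun π => M.value_eq_tsum π g s hc]
  exact Measurable.tsum fun t => (ENNReal.measurable_ofReal.comp
    (Finset.measurable_sum _ fun z _ => M.measurable_occ g s t z)).const_mul _

/-- With constant costs, value bounds reduce to real inequalities on finite horizons, where the
potential arguments apply without finiteness issues. -/
lemma value_le_iff {c B : ℝ} (hc : ∀ s a, M.cost s a = Measure.dirac c) (hc0 : 0 ≤ c)
    (hB : 0 ≤ B) :
    M.value π g s ≤ ENNReal.ofReal B ↔
      ∀ T, c * ∑ t ∈ Finset.range T, ∑ z, M.occ π g s t z ≤ B := by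
  have hn : ∀ t, 0 ≤ ∑ z, M.occ π g s t z := fun t =>
    Finset.sum_nonneg fun z _ => M.occ_nonneg π g s t z
  have h1 : ∀ T, ∑ t ∈ Finset.range T, ENNReal.ofReal c * ENNReal.ofReal (∑ z, M.occ π g s t z) =
      ENNReal.ofReal (c * ∑ t ∈ Finset.range T, ∑ z, M.occ π g s t z) := by
    intro T
    rw [ENNReal.ofReal_mul hc0, ENNReal.ofReal_sum_of_nonneg fun t _ => hn t, Finset.mul_sum]
  rw [M.value_eq_tsum π g s hc]
  constructor
  · intro h T
    rw [← ENNReal.ofReal_le_ofReal_iff hB, ← h1]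
    exact (ENNReal.sum_le_tsum _).trans h
  · intro h
    refine ENNReal.tsum_le_of_sum_range_le fun T => ?_
    rw [h1]
    exact ENNReal.ofReal_le_ofReal (h T)

end

/-! ### Change of measure between two MDPs, up to a stopping time -/

section

variable {S A : Type} [Fintype S] [Fintype A] [MeasurableSpace S] [MeasurableSpace A]
  [DiscreteMeasurableSpace S] [DiscreteMeasurableSpace A]

/-- The ratio `R` of the transition probabilities at the `k`-th transition. -/
def ratioAt (R : S × A → S → ℝ) (k : ℕ) (ω : ℕ → Step S A) : ℝ :=
  R ((ω k).1, (ω k).2.1) (ω (k + 1)).1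

/-- The likelihood ratio of the first `t` transitions. -/
def lik (R : S × A → S → ℝ) (t : ℕ) (ω : ℕ → Step S A) : ℝ :=
  ∏ k ∈ Finset.range t, ratioAt R k ω

lemma measurable_ratioAt (R : S × A → S → ℝ) (k : ℕ) :
    Measurable (ratioAt R k : (ℕ → Step S A) → ℝ) :=
  (Measurable.of_discrete (f := fun p : (S × A) × S => R p.1 p.2)).comp
    (f := fun ω : ℕ → Step S A => (((ω k).1, (ω k).2.1), (ω (k + 1)).1)) (by fun_prop)

lemma measurable_lik (R : S × A → S → ℝ) (t : ℕ) :
    Measurable (lik R t : (ℕ → Step S A) → ℝ) :=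
  Finset.measurable_prod _ fun k _ => measurable_ratioAt R k

lemma dependsOn_ratioAt (R : S × A → S → ℝ) {k n : ℕ} (h : k < n) :
    DependsOn (ratioAt R k : (ℕ → Step S A) → ℝ) (Set.Iic n) := by
  intro ω ω' hω
  rw [ratioAt, ratioAt, hω k h.le, hω (k + 1) h]

lemma dependsOn_lik (R : S × A → S → ℝ) (n : ℕ) :
    DependsOn (lik R n : (ℕ → Step S A) → ℝ) (Set.Iic n) := by
  intro ω ω' hω
  exact Finset.prod_congr rfl fun k hk => dependsOn_ratioAt R (Finset.mem_range.1 hk) hω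

lemma glue_congr {X : Type} {n : ℕ} {ω ω' : ℕ → X} (h : ∀ i ≤ n, ω i = ω' i) (y : X) :
    glue n ω y = glue n ω' y := by
  funext i
  unfold glue
  split_ifs with hi
  · exact h i hi
  · rfl

variable {M M' : MDP S A} {R : S × A → S → ℝ} (π : HistPolicy S A) (s : S)

/-- Change of measure for functions of finitely many steps. -/
lemma lintegral_law_eq_lik (hR : ∀ z x, 0 ≤ R z x) (hc : ∀ x a, M'.cost x a = M.cost x a)
    (hP : ∀ x a y, M'.P x a y = R (x, a) y * M.P x a y) (n : ℕ) {F : (ℕ → Step S A) → ℝ≥0∞}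
    (hF : Measurable F) (hd : DependsOn F (Set.Iic n)) :
    ∫⁻ ω, F ω ∂(M'.law π s) = ∫⁻ ω, F ω * ENNReal.ofReal (lik R n ω) ∂(M.law π s) := by
  induction n generalizing F with
  | zero =>
    simp only [lik, Finset.range_zero, Finset.prod_empty, ENNReal.ofReal_one, mul_one]
    have hF' : Measurable fun y : Step S A => F fun _ => y := hF.comp (by fun_prop)
    rw [M'.lintegral_law_zero π s hF hd, M.lintegral_law_zero π s hF hd,
      M'.lintegral_stepLaw _ _ hF', M.lintegral_stepLaw _ _ hF']
    simp only [hc]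
  | succ n ih =>
    let G : (ℕ → Step S A) → ℝ≥0∞ := fun ω =>
      ∫⁻ y, F (glue n ω y) * ENNReal.ofReal (R ((ω n).1, (ω n).2.1) y.1) ∂(M.nextAlong π n ω)
    have hR' : Measurable fun p : (ℕ → Step S A) × Step S A =>
        ENNReal.ofReal (R ((p.1 n).1, (p.1 n).2.1) p.2.1) :=
      (Measurable.of_discrete (f := fun p : (S × A) × S => ENNReal.ofReal (R p.1 p.2))).comp
        (f := fun p : (ℕ → Step S A) × Step S A => (((p.1 n).1, (p.1 n).2.1), p.2.1)) (by fun_prop)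
    have hFg : Measurable fun p : (ℕ → Step S A) × Step S A => F (glue n p.1 p.2) :=
      hF.comp (measurable_glue n)
    have hG : Measurable G := M.measurable_lintegral_nextAlong π n (hFg.mul hR')
    have hGd : DependsOn G (Set.Iic n) := by
      intro ω ω' h
      have h1 : Preorder.frestrictLe (π := fun _ => Step S A) n ω =
          Preorder.frestrictLe (π := fun _ => Step S A) n ω' := by
        funext i
        exact h i (Finset.mem_Iic.1 i.2)
      simp only [G, nextAlong, h1, h n (by simp), glue_congr h]
    have hFω : ∀ ω, Measurable fun y => F (glue n ω y) := fun ω => hFg.comp (measurable_prodMk_left (x := ω))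
    have h1 : ∀ ω, ∫⁻ y, F (glue n ω y) ∂(M'.nextAlong π n ω) = G ω := by
      intro ω
      have h2 : Measurable fun y : Step S A =>
          F (glue n ω y) * ENNReal.ofReal (R ((ω n).1, (ω n).2.1) y.1) :=
        (hFω ω).mul (hR'.comp (f := fun y => (ω, y)) (by fun_prop))
      simp only [G]
      rw [M'.lintegral_nextAlong _ _ _ (hFω ω), M.lintegral_nextAlong _ _ _ h2]
      refine Finset.sum_congr rfl fun x _ => ?_
      rw [hP, ENNReal.ofReal_mul (hR _ _), mul_comm (ENNReal.ofReal (R _ _)), mul_assoc,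
        Finset.mul_sum]
      congr 1
      refine Finset.sum_congr rfl fun a _ => ?_
      have h3 : Measurable fun c : ℝ => F (glue n ω (x, a, c)) := (hFω ω).comp (by fun_prop)
      dsimp only
      rw [lintegral_mul_const _ h3, hc]
      ring
    rw [M'.lintegral_law_succ π s n hF hd]
    simp only [h1]
    have hFl : Measurable fun ω => F ω * ENNReal.ofReal (lik R (n + 1) ω) :=
      hF.mul (measurable_lik R _).ennreal_ofReal
    rw [ih hG hGd, M.lintegral_law_succ π s n hFl]
    · refine lintegral_congr fun ω => ?_
      simp only [G]
      have h2 : Measurable fun y : Step S A =>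
          F (glue n ω y) * ENNReal.ofReal (R ((ω n).1, (ω n).2.1) y.1) :=
        (hFω ω).mul (hR'.comp (f := fun y => (ω, y)) (by fun_prop))
      rw [← lintegral_mul_const _ h2]
      refine lintegral_congr fun y => ?_
      have h3 : lik R (n + 1) (glue n ω y) = lik R n ω * R ((ω n).1, (ω n).2.1) y.1 := by
        rw [lik, Finset.prod_range_succ]
        congr 1
        · exact dependsOn_lik R n fun i hi => glue_of_le ω y hi
        · rw [ratioAt, glue_of_le _ _ le_rfl, glue_succ]
      rw [h3, ENNReal.ofReal_mul (show 0 ≤ lik R n ω from Finset.prod_nonneg fun _ _ => hR _ _),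
        mul_assoc,
        mul_comm (ENNReal.ofReal (R _ _))]
    · intro ω ω' h
      simp only [hd h, dependsOn_lik R (n + 1) h]

/-- Conditionally on the past, the next state is distributed according to the transition
probabilities. -/
lemma law_inter_next (M : MDP S A) (k : ℕ) {G : Set (ℕ → Step S A)} (hG : MeasurableSet G)
    (hd : DependsOn (fun ω => ω ∈ G) (Set.Iic k)) {z : S × A}
    (hz : ∀ ω ∈ G, ((ω k).1, (ω k).2.1) = z) (x : S) :
    M.law π s (G ∩ {ω | (ω (k + 1)).1 = x}) = ENNReal.ofReal (M.P z.1 z.2 x) * M.law π s G := by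
  classical
  have hx : ∀ k, MeasurableSet {ω : ℕ → Step S A | (ω k).1 = x} := fun k =>
    (MeasurableSet.of_discrete (s := {y : S | y = x})).preimage
      (f := fun ω : ℕ → Step S A => (ω k).1) (by fun_prop)
  let H : Step S A → ℝ≥0∞ := fun y => if y.1 = x then 1 else 0
  have hH : Measurable H := (Measurable.of_discrete (f := fun y : S => if y = x then
    (1 : ℝ≥0∞) else 0)).comp measurable_fst
  have hd' : ∀ ω ω' : ℕ → Step S A, (∀ i ≤ k, ω i = ω' i) → (ω ∈ G ↔ ω' ∈ G) :=
    fun ω ω' h => iff_of_eq (hd h)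
  rw [← lintegral_indicator_one (hG.inter (hx _)), ← lintegral_indicator_one hG,
    M.lintegral_law_succ π s k (measurable_one.indicator (hG.inter (hx _))),
    ← lintegral_const_mul _ (measurable_one.indicator hG)]
  · refine lintegral_congr fun ω => ?_
    have h1 : ∀ y, (G ∩ {ω | (ω (k + 1)).1 = x}).indicator (1 : (ℕ → Step S A) → ℝ≥0∞)
        (glue k ω y) = G.indicator (1 : (ℕ → Step S A) → ℝ≥0∞) ω * H y := by
      intro y
      have h2 : glue k ω y ∈ G ↔ ω ∈ G := hd' _ _ fun i hi => glue_of_le ω y hi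
      simp only [Set.indicator_apply, Set.mem_inter_iff, Set.mem_ofPred_eq, h2, glue_succ, H,
        Pi.one_apply]
      by_cases h3 : ω ∈ G <;> by_cases h4 : y.1 = x <;> simp [h3, h4]
    simp only [h1]
    rw [lintegral_const_mul _ hH, M.lintegral_nextAlong _ _ _ hH]
    by_cases h3 : ω ∈ G
    · have h5 := hz ω h3
      have h6 : ∀ y, ∑ a, ENNReal.ofReal (π.act (k + 1) (fun i => ω i, y) a) *
          ∫⁻ c, H (y, a, c) ∂(M.cost y a) = if y = x then 1 else 0 := by
        intro y
        have h7 : ∀ a, ∫⁻ c, H (y, a, c) ∂(M.cost y a) = if y = x then 1 else 0 := by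
          intro a
          have := M.cost_prob y a
          rw [show (fun c : ℝ => H (y, a, c)) = fun _ => if y = x then 1 else 0 from rfl,
            lintegral_const, measure_univ, mul_one]
        simp only [h7]
        rw [← Finset.sum_mul, sum_ofReal, one_mul]
      simp only [h6]
      rw [← h5]
      simp [h3]
    · simp [h3]
  · intro ω ω' h
    have h1 := hd' ω ω' fun i hi => h i (Nat.le_succ_of_le hi)
    simp only [Set.indicator_apply, Set.mem_inter_iff, Set.mem_ofPred_eq, h1,
      h (k + 1) (by simp), Pi.one_apply]

open Classical in
/-- The likelihood ratio of the transitions that start before time `T` and while the events `N k`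
hold. -/
def stopLik (N : ℕ → Set (ℕ → Step S A)) (R : S × A → S → ℝ) (T : ℕ) (ω : ℕ → Step S A) : ℝ :=
  ∏ k ∈ Finset.range T, if ω ∈ N k then ratioAt R k ω else 1

/-- The trajectories on which the events `N` fail at time `t` for the first time. -/
def stopSet (N : ℕ → Set (ℕ → Step S A)) (t : ℕ) : Set (ℕ → Step S A) :=
  {ω | (∀ i < t, ω ∈ N i) ∧ ω ∉ N t}

variable {N : ℕ → Set (ℕ → Step S A)}

lemma measurable_stopLik (hN : ∀ k, MeasurableSet (N k)) (T : ℕ) :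
    Measurable (stopLik N R T) :=
  Finset.measurable_prod _ fun k _ =>
    Measurable.ite (hN k) (measurable_ratioAt R k) measurable_const

lemma measurableSet_stopSet (hN : ∀ k, MeasurableSet (N k)) (t : ℕ) :
    MeasurableSet (stopSet N t) := by
  have : stopSet N t = (⋂ i, ⋂ (_ : i < t), N i) ∩ (N t)ᶜ := by
    ext; simp [stopSet]
  rw [this]
  exact (MeasurableSet.iInter fun i => MeasurableSet.iInter fun _ => hN i).inter (hN t).compl

lemma dependsOn_stopSet (hNd : ∀ k, DependsOn (fun ω => ω ∈ N k) (Set.Iic k)) (t : ℕ) :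
    DependsOn (fun ω => ω ∈ stopSet N t) (Set.Iic t) := by
  intro ω ω' h
  have h1 : ∀ i ≤ t, (ω ∈ N i) = (ω' ∈ N i) := fun i hi =>
    hNd i fun j hj => h j (le_trans hj hi)
  simp only [stopSet, Set.mem_ofPred_eq, h1 t le_rfl]
  congr 1
  exact propext (forall₂_congr fun i hi => by rw [h1 i hi.le])

/-- The events decrease, so after their first failure every factor is `1` and the stopped product
freezes at its value at time `t`. -/
lemma stopLik_eq_of_mem_stopSet (hNa : Antitone N) {t T : ℕ} (ht : t ≤ T) {ω : ℕ → Step S A}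
    (hω : ω ∈ stopSet N t) : stopLik N R T ω = lik R t ω := by
  classical
  have h1 : ∏ k ∈ Finset.Ico t T, (if ω ∈ N k then ratioAt R k ω else 1) = 1 :=
    Finset.prod_eq_one fun k hk => if_neg fun h => hω.2 (hNa (Finset.mem_Ico.1 hk).1 h)
  rw [stopLik, ← Finset.prod_range_mul_prod_Ico _ ht]
  refine (congrArg₂ (· * ·) (Finset.prod_congr rfl fun k hk =>
    if_pos (hω.1 k (Finset.mem_range.1 hk))) ?_).trans (mul_one _)
  convert h1

lemma stopLik_eq_of_mem (hNa : Antitone N) {T : ℕ} {ω : ℕ → Step S A} (hω : ω ∈ N T) :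
    stopLik N R T ω = lik R T ω :=
  Finset.prod_congr rfl fun _ hk => if_pos (hNa (Finset.mem_range.1 hk).le hω)

lemma mem_or_exists_mem_stopSet (N : ℕ → Set (ℕ → Step S A)) (T : ℕ) (ω : ℕ → Step S A) :
    (∃ t ≤ T, ω ∈ stopSet N t) ∨ ∀ t ≤ T, ω ∈ N t := by
  classical
  by_cases h : ∃ t, t ≤ T ∧ ω ∉ N t
  · left
    refine ⟨Nat.find h, (Nat.find_spec h).1, fun i hi => ?_, (Nat.find_spec h).2⟩
    by_contra hc
    exact Nat.find_min h hi ⟨hi.le.trans (Nat.find_spec h).1, hc⟩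
  · right
    push Not at h
    exact h

/-- A trajectory either has a first failure time at most `T`, which is unique, or still satisfies `N
T`. Thus a stopped function splits into pieces that each depend on finitely many steps. -/
lemma indicator_decomp (hNa : Antitone N) (T : ℕ) (ω : ℕ → Step S A) (c : ℝ≥0∞) :
    c = ∑ t ∈ Finset.range (T + 1), (stopSet N t).indicator (fun _ => c) ω +
      (N T).indicator (fun _ => c) ω := by
  classical
  rcases mem_or_exists_mem_stopSet N T ω with ⟨t, ht, h⟩ | h
  · have h1 : ω ∉ N T := fun h' => h.2 (hNa ht h')
    rw [Finset.sum_eq_single t, Set.indicator_of_mem h, Set.indicator_of_notMem h1, add_zero]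
    · intro t' _ hne
      refine Set.indicator_of_notMem (fun h' => ?_) _
      rcases lt_or_gt_of_ne hne with hlt | hlt
      · exact h'.2 (h.1 _ hlt)
      · exact h.2 (h'.1 _ hlt)
    · intro hn
      exact absurd (Finset.mem_range.2 (Nat.lt_succ_of_le ht)) hn
  · rw [Finset.sum_eq_zero, Set.indicator_of_mem (h T le_rfl), zero_add]
    intro t ht
    exact Set.indicator_of_notMem
      (fun h' => h'.2 (h t (Nat.le_of_lt_succ (Finset.mem_range.1 ht)))) _

/-- Change of measure up to a bounded stopping time. -/
lemma lintegral_law_eq_stopLik (hR : ∀ z x, 0 ≤ R z x) (hc : ∀ x a, M'.cost x a = M.cost x a)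
    (hP : ∀ x a y, M'.P x a y = R (x, a) y * M.P x a y) (hN : ∀ k, MeasurableSet (N k))
    (hNa : Antitone N) (T : ℕ)
    {F : (ℕ → Step S A) → ℝ≥0∞} (hF : Measurable F)
    (hFd : ∀ t ≤ T, DependsOn ((stopSet N t).indicator F) (Set.Iic t))
    (hFT : DependsOn ((N T).indicator F) (Set.Iic T)) :
    ∫⁻ ω, F ω ∂(M'.law π s) = ∫⁻ ω, F ω * ENNReal.ofReal (stopLik N R T ω) ∂(M.law π s) := by
  have hdec : ∀ F : (ℕ → Step S A) → ℝ≥0∞, ∀ ω, F ω =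
      ∑ t ∈ Finset.range (T + 1), (stopSet N t).indicator F ω + (N T).indicator F ω :=
    fun F ω => indicator_decomp hNa T ω (F ω)
  have hint : ∀ (μ : Measure (ℕ → Step S A)) {F : (ℕ → Step S A) → ℝ≥0∞}, Measurable F →
      ∫⁻ ω, F ω ∂μ = ∑ t ∈ Finset.range (T + 1), ∫⁻ ω, (stopSet N t).indicator F ω ∂μ +
        ∫⁻ ω, (N T).indicator F ω ∂μ := by
    intro μ F hF
    rw [lintegral_congr (hdec F), lintegral_add_right _ (hF.indicator (hN T)),
      lintegral_finsetSum _ fun t _ => hF.indicator (measurableSet_stopSet hN t)]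
  have hX : Measurable fun ω => ENNReal.ofReal (stopLik N R T ω) :=
    (measurable_stopLik hN T).ennreal_ofReal
  have hFX : Measurable fun ω => F ω * ENNReal.ofReal (stopLik N R T ω) := hF.mul hX
  refine (hint (M'.law π s) hF).trans (Eq.trans ?_ (hint (M.law π s) hFX).symm)
  refine congr_arg₂ (· + ·) (Finset.sum_congr rfl fun t ht => ?_) ?_
  · have ht' : t ≤ T := Nat.le_of_lt_succ (Finset.mem_range.1 ht)
    rw [lintegral_law_eq_lik π s hR hc hP t (hF.indicator (measurableSet_stopSet hN t))
      (hFd t ht')]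
    refine lintegral_congr fun ω => ?_
    by_cases h : ω ∈ stopSet N t
    · rw [Set.indicator_of_mem h, Set.indicator_of_mem h, stopLik_eq_of_mem_stopSet hNa ht' h]
    · rw [Set.indicator_of_notMem h, Set.indicator_of_notMem h, zero_mul]
  · rw [lintegral_law_eq_lik π s hR hc hP T (hF.indicator (hN T)) hFT]
    refine lintegral_congr fun ω => ?_
    by_cases h : ω ∈ N T
    · rw [Set.indicator_of_mem h, Set.indicator_of_mem h, stopLik_eq_of_mem hNa h]
    · rw [Set.indicator_of_notMem h, Set.indicator_of_notMem h, zero_mul]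

end

end MDP

/-! ### Testing lower bounds from the log-likelihood ratio -/

/-- A binary data-processing inequality for a density `X` of mass at most `1` that gives mass at
most `δ` to `E`. -/
lemma le_integral_neg_log {Ω : Type*} [MeasurableSpace Ω] {μ : Measure Ω} [IsProbabilityMeasure μ]
    {X : Ω → ℝ} (hX : ∀ ω, 0 < X ω) (hXi : Integrable X μ)
    (hli : Integrable (fun ω => Real.log (X ω)) μ) (h1 : ∫ ω, X ω ∂μ ≤ 1) {E : Set Ω}
    (hE : MeasurableSet E) {δ : ℝ} (hδ : 0 < δ) (hEδ : ∫ ω in E, X ω ∂μ ≤ δ) :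
    μ.real E * Real.log (1 / δ) - Real.log 2 ≤ ∫ ω, -Real.log (X ω) ∂μ := by
  have hlog : ∀ {x c : ℝ}, 0 < x → 0 < c → 1 - Real.log c - x * c⁻¹ ≤ -Real.log x := by
    intro x c hx hc
    have := Real.log_le_sub_one_of_pos (div_pos hx hc)
    rw [Real.log_div hx.ne' hc.ne', div_eq_mul_inv] at this
    linarith
  have hpart : ∀ {E : Set Ω}, MeasurableSet E → ∀ {c : ℝ}, 0 < c →
      μ.real E * (1 - Real.log c) - (∫ ω in E, X ω ∂μ) * c⁻¹ ≤ ∫ ω in E, -Real.log (X ω) ∂μ := by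
    intro E hE c hc
    have h2 : ∫ ω in E, (1 - Real.log c - X ω * c⁻¹) ∂μ =
        μ.real E * (1 - Real.log c) - (∫ ω in E, X ω ∂μ) * c⁻¹ := by
      rw [integral_sub (integrable_const _) (hXi.integrableOn.mul_const _), integral_mul_const]
      simp
    rw [← h2]
    refine setIntegral_mono ?_ hli.neg.integrableOn fun ω => hlog (hX ω) hc
    exact (integrable_const _).sub (hXi.integrableOn.mul_const _)
  -- The tangent line of `-log` is taken at `2δ` on `E` and at `2` off `E`. Each of the two linear
  -- terms then costs at most `1/2`, and together they cancel the constant `1`.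
  have hA := hpart hE (c := 2 * δ) (by positivity)
  have hB := hpart hE.compl (c := 2) (by norm_num)
  have hC : ∫ ω in Eᶜ, X ω ∂μ ≤ 1 := (setIntegral_le_integral hXi
    (Filter.Eventually.of_forall fun ω => (hX ω).le)).trans h1
  have hsplit : ∫ ω in E, -Real.log (X ω) ∂μ + ∫ ω in Eᶜ, -Real.log (X ω) ∂μ =
      ∫ ω, -Real.log (X ω) ∂μ := integral_add_compl hE hli.neg
  rw [← hsplit]
  rw [probReal_compl_eq_one_sub hE] at hB
  rw [Real.log_mul (by norm_num) hδ.ne'] at hA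
  have hD : (∫ ω in E, X ω ∂μ) * (2 * δ)⁻¹ ≤ 1 / 2 := by
    rw [← div_eq_mul_inv, div_le_iff₀ (by positivity)]
    linarith
  have hF : (∫ ω in Eᶜ, X ω ∂μ) * 2⁻¹ ≤ 1 / 2 := by linarith
  rw [one_div, Real.log_inv]
  nlinarith

namespace MDP

section

variable {S A : Type} [Fintype S] [Fintype A] [MeasurableSpace S] [MeasurableSpace A]
  [DiscreteMeasurableSpace S] [DiscreteMeasurableSpace A]

variable {M M' : MDP S A} {R : S × A → S → ℝ} (π : HistPolicy S A) (s : S)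
  {N : ℕ → Set (ℕ → Step S A)}

/-- The trajectories that take the action `z.2` at the state `z.1` at time `k`. -/
def visits (z : S × A) (k : ℕ) : Set (ℕ → Step S A) := {ω | ((ω k).1, (ω k).2.1) = z}

lemma measurableSet_visits (z : S × A) (k : ℕ) : MeasurableSet (visits z k) :=
  (MeasurableSet.of_discrete (s := {x : S × A | x = z})).preimage
    (f := fun ω : ℕ → Step S A => ((ω k).1, (ω k).2.1)) (by fun_prop)

lemma stopLik_pos (hR : ∀ z x, 0 < R z x) (T : ℕ) (ω : ℕ → Step S A) :
    0 < stopLik N R T ω := by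
  refine Finset.prod_pos fun k _ => ?_
  split_ifs
  · exact hR _ _
  · exact one_pos

/-- The ratio takes finitely many values, so a product of `T` of them is bounded. This gives
integrability of the stopped density. -/
lemma exists_stopLik_le (hR : ∀ z x, 0 < R z x) (N : ℕ → Set (ℕ → Step S A)) (T : ℕ) :
    ∃ B, ∀ ω, stopLik N R T ω ≤ B := by
  obtain ⟨B, hB⟩ := (Set.finite_range (fun p : (S × A) × S => R p.1 p.2)).bddAbove
  have hB' : ∀ z x, R z x ≤ B := fun z x => hB ⟨(z, x), rfl⟩
  refine ⟨∏ _k ∈ Finset.range T, max B 1, fun ω => ?_⟩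
  refine Finset.prod_le_prod (fun k _ => ?_) fun k _ => ?_
  · split_ifs
    · exact (hR _ _).le
    · exact zero_le_one
  · split_ifs
    · exact (hB' _ _).trans (le_max_left _ _)
    · exact le_max_right _ _

open Classical in
/-- The expected log-likelihood ratio at time `k`. -/
lemma integral_log_ratioAt (hR1 : ∀ z', z' ≠ z → ∀ x, R z' x = 1) (k : ℕ)
    (hN : MeasurableSet (N k)) (hNd : DependsOn (fun ω => ω ∈ N k) (Set.Iic k)) :
    Integrable (fun ω => if ω ∈ N k then -Real.log (ratioAt R k ω) else 0) (M.law π s) ∧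
    ∫ ω, (if ω ∈ N k then -Real.log (ratioAt R k ω) else 0) ∂(M.law π s) =
      (∑ x, M.P z.1 z.2 x * -Real.log (R z x)) * (M.law π s).real (N k ∩ visits z k) := by
  set G := N k ∩ visits z k
  have hG : MeasurableSet G := hN.inter (measurableSet_visits z k)
  have hx : ∀ x, MeasurableSet {ω : ℕ → Step S A | (ω (k + 1)).1 = x} := fun x =>
    (MeasurableSet.of_discrete (s := {y : S | y = x})).preimage
      (f := fun ω : ℕ → Step S A => (ω (k + 1)).1) (by fun_prop)
  have h1 : (fun ω => if ω ∈ N k then -Real.log (ratioAt R k ω) else 0) = fun ω =>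
      ∑ x, (G ∩ {ω | (ω (k + 1)).1 = x}).indicator (fun _ => -Real.log (R z x)) ω := by
    funext ω
    by_cases h : ω ∈ N k
    · by_cases hz : ω ∈ visits z k
      · rw [Finset.sum_eq_single (ω (k + 1)).1]
        · have hm : ω ∈ G ∩ {ω' : ℕ → Step S A | (ω' (k + 1)).1 = (ω (k + 1)).1} :=
            ⟨⟨h, hz⟩, rfl⟩
          rw [Set.indicator_of_mem hm, if_pos h, ratioAt, show (_, _) = z from hz]
        · intro x _ hne
          exact Set.indicator_of_notMem (fun h' => hne h'.2.symm) _
        · simp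
      · rw [if_pos h, ratioAt, hR1 _ hz, Finset.sum_eq_zero]
        · simp
        · intro x _
          exact Set.indicator_of_notMem (fun h' => hz h'.1.2) _
    · rw [if_neg h, Finset.sum_eq_zero]
      intro x _
      exact Set.indicator_of_notMem (fun h' => h h'.1.1) _
  have hi : ∀ x, Integrable ((G ∩ {ω | (ω (k + 1)).1 = x}).indicator
      (fun _ => -Real.log (R z x))) (M.law π s) := fun x =>
    (integrable_const _).indicator (hG.inter (hx x))
  have hGd : DependsOn (fun ω => ω ∈ G) (Set.Iic k) := by
    intro ω ω' h
    simp only [G, Set.mem_inter_iff, visits, Set.mem_ofPred_eq, h k (by simp)]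
    rw [show (ω ∈ N k) = (ω' ∈ N k) from hNd h]
  rw [h1]
  refine ⟨integrable_finsetSum _ fun x _ => hi x, ?_⟩
  rw [integral_finsetSum _ fun x _ => hi x, Finset.sum_mul]
  refine Finset.sum_congr rfl fun x _ => ?_
  rw [integral_indicator_const _ (hG.inter (hx x)), measureReal_def,
    law_inter_next π s M k hG hGd (fun ω hω => hω.2) x, ENNReal.toReal_mul,
    ENNReal.toReal_ofReal (show 0 ≤ M.P z.1 z.2 x from (M.P z.1 z.2).2.1 x), measureReal_def, smul_eq_mul]
  ring

/-- Testing lower bound: if an event that is decided when the events `N` stop is likely under `M` and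
unlikely under `M'`, and the two MDPs only differ at `z`, then `z` is visited often under `M`. -/
lemma log_le_sum_visits (hR : ∀ z x, 0 < R z x) (hR1 : ∀ z', z' ≠ z → ∀ x, R z' x = 1)
    (hc : ∀ x a, M'.cost x a = M.cost x a)
    (hP : ∀ x a y, M'.P x a y = R (x, a) y * M.P x a y) (hN : ∀ k, MeasurableSet (N k))
    (hNa : Antitone N) (hNd : ∀ k, DependsOn (fun ω => ω ∈ N k) (Set.Iic k))
    {B : Set (ℕ → Step S A)} (hB : MeasurableSet B)
    (hBd : ∀ t, DependsOn (fun ω => ω ∈ B ∩ stopSet N t) (Set.Iic t))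
    (hBs : ∀ ω ∈ B, ∃ t, ω ∉ N t) {κ δ : ℝ}
    (hκ : ∑ x, M.P z.1 z.2 x * -Real.log (R z x) ≤ κ)
    (hδ : 0 < δ) (hδ' : δ ≤ 1 / 16) (hMB : 1 / 2 ≤ (M.law π s).real B)
    (hMB' : M'.law π s B ≤ ENNReal.ofReal δ) :
    ∃ T, Real.log (1 / δ) / 8 ≤
      κ * ∑ k ∈ Finset.range T, (M.law π s).real (N k ∩ visits z k) := by
  classical
  -- Every trajectory of `B` stops, so by continuity from below a finite horizon retains mass `3/8`
  -- of the available `1/2`.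
  obtain ⟨T, hT⟩ : ∃ T, 3 / 8 ≤ (M.law π s).real (B ∩ (N T)ᶜ) := by
    have h1 : Filter.Tendsto (fun T => M.law π s (B ∩ (N T)ᶜ)) Filter.atTop
        (nhds (M.law π s (⋃ T, B ∩ (N T)ᶜ))) :=
      tendsto_measure_iUnion_atTop fun i j hij =>
        Set.inter_subset_inter_right _ (Set.compl_subset_compl.2 (hNa hij))
    have h2 : ⋃ T, B ∩ (N T)ᶜ = B := by
      ext ω
      simp only [Set.mem_iUnion, Set.mem_inter_iff, Set.mem_compl_iff, exists_and_left,
        and_iff_left_iff_imp]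
      exact hBs ω
    rw [h2] at h1
    have h3 := (ENNReal.tendsto_toReal (measure_ne_top _ _)).comp h1
    have h4 : (3 / 8 : ℝ) < (M.law π s B).toReal := lt_of_lt_of_le (by norm_num) hMB
    exact (h3.eventually (lt_mem_nhds h4)).exists.imp fun T h => le_of_lt h
  refine ⟨T, ?_⟩
  set μ := M.law π s
  set X := stopLik N R T
  set E := B ∩ (N T)ᶜ
  have hE : MeasurableSet E := hB.inter (hN T).compl
  have hR0 : ∀ z x, 0 ≤ R z x := fun z x => (hR z x).le
  have hXm : Measurable X := measurable_stopLik hN T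
  have hXpos : ∀ ω, 0 < X ω := stopLik_pos hR T
  obtain ⟨b, hb⟩ := exists_stopLik_le hR N T
  have hXi : Integrable X μ := Integrable.of_bound hXm.aestronglyMeasurable b
    (Filter.Eventually.of_forall fun ω => by
      rw [Real.norm_of_nonneg (hXpos ω).le]; exact hb ω)
  have hlogX : ∀ ω, -Real.log (X ω) =
      ∑ k ∈ Finset.range T, if ω ∈ N k then -Real.log (ratioAt R k ω) else 0 := by
    intro ω
    simp only [X, stopLik]
    rw [Real.log_prod, ← Finset.sum_neg_distrib]
    · refine Finset.sum_congr rfl fun k _ => ?_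
      split_ifs <;> simp
    · intro k _
      split_ifs
      · exact (hR _ _).ne'
      · exact one_ne_zero
  have hterm := fun k => integral_log_ratioAt (M := M) π s (z := z) hR1 k (hN k) (hNd k)
  have hli : Integrable (fun ω => Real.log (X ω)) μ := by
    have : (fun ω => Real.log (X ω)) = fun ω =>
        -∑ k ∈ Finset.range T, if ω ∈ N k then -Real.log (ratioAt R k ω) else 0 := by
      funext ω
      rw [← hlogX, neg_neg]
    rw [this]
    exact (integrable_finsetSum _ fun k _ => (hterm k).1).neg
  -- The stopped product is the density of the law under `M'` on events decided by the stopping time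
  -- truncated at `T`.
  have hchange : ∀ {C : Set (ℕ → Step S A)}, MeasurableSet C →
      (∀ t ≤ T, DependsOn (fun ω => ω ∈ C ∩ stopSet N t) (Set.Iic t)) →
      DependsOn (fun ω => ω ∈ C ∩ N T) (Set.Iic T) →
      ∫ ω in C, X ω ∂μ = (M'.law π s).real C := by
    intro C hC h1 h2
    have hind : ∀ {D : Set (ℕ → Step S A)} {t : ℕ}, DependsOn (fun ω => ω ∈ C ∩ D) (Set.Iic t) →
        DependsOn (D.indicator (C.indicator (1 : (ℕ → Step S A) → ℝ≥0∞))) (Set.Iic t) := by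
      intro D t h ω ω' hω
      have := h hω
      rw [Set.indicator_indicator, Set.inter_comm]
      simp only [Set.indicator_apply, show (ω ∈ C ∩ D) = (ω' ∈ C ∩ D) from this, Pi.one_apply]
    have := lintegral_law_eq_stopLik π s hR0 hc hP hN hNa T (measurable_one.indicator hC)
      (fun t ht => hind (h1 t ht)) (hind h2)
    rw [lintegral_indicator_one hC] at this
    rw [integral_eq_lintegral_of_nonneg_ae (Filter.Eventually.of_forall fun ω => (hXpos ω).le)
      hXm.aestronglyMeasurable, measureReal_def, this, ← lintegral_indicator hC]
    congr 1
    refine lintegral_congr fun ω => ?_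
    by_cases h : ω ∈ C <;> simp [h, X]
  have hX1 : ∫ ω, X ω ∂μ ≤ 1 := by
    rw [← setIntegral_univ, hchange MeasurableSet.univ]
    · exact measureReal_le_one
    · intro t _
      simpa using dependsOn_stopSet hNd t
    · simpa using hNd T
  have hXE : ∫ ω in E, X ω ∂μ ≤ δ := by
    rw [hchange hE]
    · refine ENNReal.toReal_le_of_le_ofReal hδ.le (le_trans (measure_mono ?_) hMB')
      exact Set.inter_subset_left
    · intro t ht ω ω' h
      have h1 : ∀ ω : ℕ → Step S A, (ω ∈ E ∩ stopSet N t) = (ω ∈ B ∩ stopSet N t) := by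
        intro ω
        refine propext ⟨fun h => ⟨h.1.1, h.2⟩, fun h => ⟨⟨h.1, fun h' => ?_⟩, h.2⟩⟩
        exact h.2.2 (hNa ht h')
      simp only [h1]
      exact hBd t h
    · intro ω ω' _
      refine propext (iff_of_false ?_ ?_) <;> exact fun h => h.1.2 h.2
  have hmain := le_integral_neg_log hXpos hXi hli hX1 hE hδ hXE
  have hint : ∫ ω, -Real.log (X ω) ∂μ ≤
      κ * ∑ k ∈ Finset.range T, μ.real (N k ∩ visits z k) := by
    simp only [hlogX]
    rw [integral_finsetSum _ fun k _ => (hterm k).1, Finset.mul_sum]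
    refine Finset.sum_le_sum fun k _ => ?_
    rw [(hterm k).2]
    exact mul_le_mul_of_nonneg_right hκ measureReal_nonneg
  refine le_trans ?_ (hmain.trans hint)
  -- Since `δ ≤ 1/16`, the loss `log 2` is at most a quarter of `log (1/δ)`, and `3/8 - 1/4 = 1/8`.
  have hl2 : 4 * Real.log 2 ≤ Real.log (1 / δ) := by
    have h16 : (4 : ℝ) * Real.log 2 = Real.log 16 := by
      rw [show (16 : ℝ) = 2 ^ 4 by norm_num, Real.log_pow]
      norm_num
    rw [h16]
    refine Real.log_le_log (by norm_num) ?_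
    rw [le_div_iff₀ hδ]
    linarith
  have hl0 : 0 < Real.log 2 := Real.log_pos (by norm_num)
  nlinarith

end

end MDP

/-! ### Lazy deterministic walks and certified hitting times -/

open Classical in
/-- The MDP with constant cost `c` in which the action `a` at `x` moves to `tgt x a` with probability
`q (x, a)` and otherwise stays at `x`. -/
def lazyMDP {S A : Type} [Fintype S] (tgt : S → A → S) (q : S × A → unitInterval) (c : ℝ) (s₀ : S)
    (r : A) : MDP S A where
  P x a := ⟨fun y => q (x, a) * (if y = tgt x a then 1 else 0) +
      (1 - q (x, a)) * (if y = x then 1 else 0), by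
    constructor
    · intro y
      have h0 := (q (x, a)).2.1
      have h1 := (q (x, a)).2.2
      refine add_nonneg (mul_nonneg h0 ?_) (mul_nonneg (sub_nonneg.2 h1) ?_) <;>
      split_ifs <;> norm_num
    · simp [Finset.sum_add_distrib]⟩
  cost _ _ := Measure.dirac c
  cost_prob _ _ := inferInstance
  s₀ := s₀
  reset := r

section

variable {S A : Type} [Fintype S] [Fintype A]

open Classical in
lemma lazyMDP_P (tgt : S → A → S) (q : S × A → unitInterval) (c : ℝ) (s₀ : S) (r : A) (x : S) (a : A)
    (y : S) : (lazyMDP tgt q c s₀ r).P x a y = q (x, a) * (if y = tgt x a then 1 else 0) +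
      (1 - q (x, a)) * (if y = x then 1 else 0) := rfl

lemma sum_lazyMDP_P (tgt : S → A → S) (q : S × A → unitInterval) (c : ℝ) (s₀ : S) (r : A) (x : S)
    (a : A) (ψ : S → ℝ) : ∑ y, (lazyMDP tgt q c s₀ r).P x a y * ψ y =
      q (x, a) * ψ (tgt x a) + (1 - q (x, a)) * ψ x := by
  classical
  simp only [lazyMDP_P, add_mul, Finset.sum_add_distrib, mul_assoc, ite_mul, one_mul, zero_mul,
    ← Finset.mul_sum]
  congr 2
  · rw [Finset.sum_eq_single (tgt x a)] <;> simp +contextual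
  · rw [Finset.sum_eq_single x] <;> simp +contextual

namespace MDP

/-- The potential `φ` certifies that the policy `π` reaches `y` from `x` in at most `φ x` expected
steps. -/
def Reaches (M : MDP S A) (y : S) (π : S → A) (φ : S → ℝ) : Prop :=
  φ y = 0 ∧ (∀ x, 0 ≤ φ x) ∧ ∀ x, x ≠ y → 1 + ∑ x', M.P x (π x) x' * φ x' ≤ φ x

/-- Once `x` is reached, repeating `a` there takes a geometric waiting time of mean `1 / q (x, a)`
to get to `y`. Adding this constant to the potential accounts for it, and lowering the potential to
`0` at `y` only helps the inequality elsewhere. -/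
lemma Reaches.extend [DecidableEq S] {tgt : S → A → S} {q : S × A → unitInterval} {c : ℝ} {s₀ : S} {r : A} {x y : S}
    {π : S → A} {φ : S → ℝ} (h : (lazyMDP tgt q c s₀ r).Reaches x π φ) {a : A} (hy : tgt x a = y)
    (hxy : x ≠ y) (hq : 0 < (q (x, a) : ℝ)) :
    (lazyMDP tgt q c s₀ r).Reaches y (Function.update π x a)
      (Function.update (fun u => φ u + 1 / q (x, a)) y 0) := by
  obtain ⟨h0, hn, hs⟩ := h
  have hq' : (0 : ℝ) ≤ 1 / q (x, a) := by positivity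
  have hle : ∀ u, Function.update (fun u => φ u + 1 / (q (x, a) : ℝ)) y 0 u ≤
      φ u + 1 / q (x, a) := by
    intro u
    by_cases hu : u = y
    · subst hu
      rw [Function.update_self]
      exact add_nonneg (hn _) hq'
    · rw [Function.update_of_ne hu]
  refine ⟨by simp, fun u => ?_, fun u hu => ?_⟩
  · by_cases hu : u = y
    · subst hu; simp
    · rw [Function.update_of_ne hu]
      exact add_nonneg (hn _) hq'
  · rw [Function.update_of_ne hu]
    by_cases hux : u = x
    · subst hux
      rw [Function.update_self, sum_lazyMDP_P, hy, Function.update_self, Function.update_of_ne hu,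
        h0, mul_zero, zero_add, zero_add, sub_mul, one_mul, mul_one_div_cancel hq.ne']
      linarith
    · rw [Function.update_of_ne hux]
      have h1 := hs u hux
      have h2 : ∑ x', (lazyMDP tgt q c s₀ r).P u (π u) x' *
          Function.update (fun u => φ u + 1 / (q (x, a) : ℝ)) y 0 x' ≤
          ∑ x', (lazyMDP tgt q c s₀ r).P u (π u) x' * (φ x' + 1 / q (x, a)) :=
        Finset.sum_le_sum fun x' _ => mul_le_mul_of_nonneg_left (hle x')
          (((lazyMDP tgt q c s₀ r).P u (π u)).2.1 x')
      have h3 : ∑ x', (lazyMDP tgt q c s₀ r).P u (π u) x' = 1 :=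
        ((lazyMDP tgt q c s₀ r).P u (π u)).2.2
      simp only [mul_add, Finset.sum_add_distrib, ← Finset.sum_mul, h3, one_mul] at h2
      linarith

variable [MeasurableSpace S] [MeasurableSpace A] [DiscreteMeasurableSpace S]
  [DiscreteMeasurableSpace A]

/-- A deterministic policy has zero occupancy on actions other than its own, so the potential
inequality is needed only along `π`. -/
lemma Reaches.value_le {M : MDP S A} {y : S} {π : S → A} {φ : S → ℝ} (h : M.Reaches y π φ) {c : ℝ}
    (hc : ∀ s a, M.cost s a = Measure.dirac c) (hc0 : 0 ≤ c) (s : S) :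
    M.value (detPolicy π) y s ≤ ENNReal.ofReal (c * φ s) := by
  obtain ⟨h0, hn, hs⟩ := h
  rw [M.value_le_iff _ _ _ hc hc0 (mul_nonneg hc0 (hn s))]
  intro T
  refine mul_le_mul_of_nonneg_left (M.sum_occ_le_of_potential _ y s h0 hn ?_ T) hc0
  intro t z hz hocc
  have : z.2 = π z.1 := by
    by_contra hne
    exact hocc (M.occ_eq_zero_of_policy _ y s (by simp [detPolicy, hne]))
  rw [this]
  exact hs z.1 hz

end MDP

end

/-! ### The tree -/

/-- Depth of a node in the `b`-ary tree in which the children of `x` are `b * x + 1, …, b * x + b`. -/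
def depth (b : ℕ) : ℕ → ℕ
  | 0 => 0
  | k + 1 => depth b (k / b) + 1
decreasing_by exact Nat.lt_succ_of_le (Nat.div_le_self k b)

lemma depth_zero (b : ℕ) : depth b 0 = 0 := by rw [depth]

lemma depth_succ (b k : ℕ) : depth b (k + 1) = depth b (k / b) + 1 := by rw [depth]

lemma depth_child {b a : ℕ} (ha : a < b) (x : ℕ) : depth b (b * x + a + 1) = depth b x + 1 := by
  rw [depth_succ, Nat.mul_add_div (by omega), Nat.div_eq_of_lt ha, add_zero]

/-- The parent of `k + 1` is `k / b`, and passing to it divides the bound `b ^ (d + 1)` by `b`. -/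
lemma depth_le {b : ℕ} (d k : ℕ) (h : k < b ^ d) : depth b k ≤ d := by
  induction d generalizing k with
  | zero =>
    obtain rfl : k = 0 := by simpa using h
    simp [depth_zero]
  | succ d ih =>
    cases k with
    | zero => simp [depth_zero]
    | succ k =>
      rw [depth_succ]
      refine Nat.succ_le_succ (ih _ (Nat.div_lt_of_lt_mul ?_))
      rw [← pow_succ']
      omega

variable {n b : ℕ}

/-- A pair of a tree node and an action that does not lead to a child of the node. -/
def IsArm (z : Fin (n + 1) × Fin (b + 1)) : Prop :=
  z.1 ≠ Fin.last n ∧ z.2 ≠ Fin.last b ∧ n ≤ b * z.1 + z.2 + 1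

open Classical in
/-- Destinations of the actions: the last action is RESET, the state `n` is the goal, and the other
states are the nodes of a `b`-ary tree, where slots without a child lead to the goal. -/
def treeTarget (x : Fin (n + 1)) (a : Fin (b + 1)) : Fin (n + 1) :=
  if a = Fin.last b ∨ x = Fin.last n then 0
  else if h : b * (x : ℕ) + a + 1 < n then ⟨b * x + a + 1, by omega⟩ else Fin.last n

lemma treeTarget_reset (x : Fin (n + 1)) : treeTarget x (Fin.last b) = 0 := by
  simp [treeTarget]

lemma treeTarget_arm {z : Fin (n + 1) × Fin (b + 1)} (hz : IsArm z) :
    treeTarget z.1 z.2 = Fin.last n := by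
  obtain ⟨h1, h2, h3⟩ := hz
  rw [treeTarget, if_neg (by tauto), dif_neg (by omega)]

/-- The lazy walk on the tree whose arms have success probabilities `q`. -/
def treeMDP (c : ℝ) (q : Fin (n + 1) × Fin (b + 1) → unitInterval) :
    MDP (Fin (n + 1)) (Fin (b + 1)) :=
  lazyMDP treeTarget q c 0 (Fin.last b)

/-- The entire state space has `n + 1` elements, so the bound on the number of controllable states
holds whatever the success probabilities of the arms. -/
lemma inClass_treeMDP {c : ℝ} (hc1 : c ≤ 1) {q : Fin (n + 1) × Fin (b + 1) → unitInterval}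
    (hq : ∀ z, ¬ IsArm z → q z = 1) {Smax : ℕ} (hS : n + 1 ≤ Smax) (L : ℝ) :
    (treeMDP c q).InClass Smax (b + 1) c L (n + 1) := by
  refine ⟨by simpa using hS, by simp, fun s a => ?_, ⟨fun s => ?_, c, ⟨le_rfl, hc1⟩, fun s => rfl⟩, ?_⟩
  · change Measure.dirac c _ = 1
    rw [Measure.dirac_apply' _ measurableSet_Icc]
    simp [hc1]
  · change (lazyMDP treeTarget q c 0 (Fin.last b)).P s (Fin.last b) 0 = 1
    rw [lazyMDP_P, hq _ (fun h => h.2.1 rfl), treeTarget_reset]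
    simp
  · refine (Set.ncard_le_card _).trans ?_
    simp

/-- The path is extended from the parent by one deterministic step. Parents have smaller labels, so
the policy needs non-reset actions only at labels below `k`; this gives the restriction required for
incremental control with respect to `<`. -/
lemma exists_reaches_node {c : ℝ} {q : Fin (n + 1) × Fin (b + 1) → unitInterval}
    (hq : ∀ z, ¬ IsArm z → q z = 1) (hb : 0 < b) (k : ℕ) (hk : k < n) :
    ∃ π φ, (treeMDP c q).Reaches ⟨k, by omega⟩ π φ ∧ φ 0 ≤ depth b k ∧
      ∀ x : Fin (n + 1), k ≤ x → π x = Fin.last b := by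
  induction k using Nat.strong_induction_on with
  | _ k ih =>
    cases k with
    | zero =>
      -- For the root, always resetting works: it takes one step from any other state.
      refine ⟨fun _ => Fin.last b, fun x => if x = 0 then 0 else 1, ⟨by simp, fun x => ?_,
        fun x hx => ?_⟩, by simp, fun _ _ => rfl⟩
      · dsimp only
        split_ifs <;> norm_num
      · have hx' : x ≠ 0 := hx
        change 1 + ∑ x', (lazyMDP treeTarget q c 0 (Fin.last b)).P x (Fin.last b) x' * _ ≤ _
        rw [sum_lazyMDP_P (ψ := fun x : Fin (n + 1) => if x = 0 then (0 : ℝ) else 1),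
          hq _ (fun h => h.2.1 rfl), treeTarget_reset]
        simp [hx']
    | succ k =>
      have hlt : k / b < k + 1 := Nat.lt_succ_of_le (Nat.div_le_self k b)
      obtain ⟨π, φ, hr, hφ, hπ⟩ := ih (k / b) hlt (by omega)
      have ha : k % b < b + 1 := (Nat.mod_lt k hb).trans (Nat.lt_succ_self b)
      have hkb : b * (k / b) + k % b = k := Nat.div_add_mod k b
      have hna : ¬ IsArm ((⟨k / b, by omega⟩ : Fin (n + 1)), (⟨k % b, ha⟩ : Fin (b + 1))) := by
        rintro ⟨-, -, h⟩
        simp only [hkb] at h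
        omega
      have ht : treeTarget (⟨k / b, by omega⟩ : Fin (n + 1)) (⟨k % b, ha⟩ : Fin (b + 1)) =
          ⟨k + 1, by omega⟩ := by
        have h1 : (⟨k % b, ha⟩ : Fin (b + 1)) ≠ Fin.last b := by
          intro h
          have := congrArg Fin.val h
          simp only [Fin.val_last] at this
          have := Nat.mod_lt k hb
          omega
        have h2 : (⟨k / b, by omega⟩ : Fin (n + 1)) ≠ Fin.last n := by
          intro h
          have := congrArg Fin.val h
          simp only [Fin.val_last] at this
          omega
        rw [treeTarget, if_neg (by tauto), dif_pos (by simp only [hkb]; omega)]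
        simp only [hkb]
      have hq1 := hq _ hna
      have hext := MDP.Reaches.extend hr ht (by
        intro h
        have := congrArg Fin.val h
        simp only at this
        omega) (by rw [hq1]; simp)
      refine ⟨_, _, hext, ?_, fun x hx => ?_⟩
      · rw [Function.update_of_ne (by
          intro h
          have := congrArg Fin.val h
          simp at this), depth_succ, hq1]
        push_cast
        simp only [div_one]
        linarith
      · rw [Function.update_of_ne]
        · exact hπ x (by omega)
        · rintro rfl
          simp only at hx
          omega

/-- The goal is incrementally controllable if some arm is good enough. -/
lemma last_mem_controllable {c L : ℝ} (hc : 0 < c) {q : Fin (n + 1) × Fin (b + 1) → unitInterval}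
    (hq : ∀ z, ¬ IsArm z → q z = 1) (hb : 0 < b)
    (hd : ∀ k < n, c * depth b k ≤ L) {w : Fin (n + 1) × Fin (b + 1)} (hw : IsArm w)
    (hw0 : 0 < (q w : ℝ)) (hwL : c * (depth b w.1 + 1 / q w) ≤ L) :
    Fin.last n ∈ (treeMDP c q).controllable L := by
  have hcost : ∀ s a, (treeMDP c q).cost s a = Measure.dirac c := fun _ _ => rfl
  have hs0 : (treeMDP c q).s₀ = 0 := rfl
  -- In the order of labels every parent precedes its children and the goal is the last state.
  refine ⟨(· < ·), inferInstance, ?_⟩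
  rintro X ⟨hX0, hX⟩
  have hnode : ∀ k, ∀ hk : k < n, (⟨k, by omega⟩ : Fin (n + 1)) ∈ X := by
    intro k
    induction k using Nat.strong_induction_on with
    | _ k ih =>
      intro hk
      obtain ⟨π, φ, hr, hφ, hπ⟩ := exists_reaches_node (c := c) hq hb k hk
      refine hX _ ⟨π, fun x hx => hπ x ?_, (hr.value_le hcost hc.le _).trans
        (ENNReal.ofReal_le_ofReal ?_)⟩
      · by_contra hlt
        exact hx ⟨ih x (by omega) (by omega), Fin.lt_def.2 (by simp only; omega)⟩
      · rw [hs0]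
        exact (mul_le_mul_of_nonneg_left hφ hc.le).trans (hd k hk)
  have hwn : (w.1 : ℕ) < n := by
    have := Fin.val_ne_of_ne hw.1
    have := w.1.2
    simp only [Fin.val_last] at *
    omega
  obtain ⟨π, φ, hr, hφ, hπ⟩ := exists_reaches_node (c := c) hq hb w.1 hwn
  have hr' : (treeMDP c q).Reaches w.1 π φ := hr
  have hext := MDP.Reaches.extend hr' (a := w.2) (treeTarget_arm hw) hw.1 hw0
  refine hX _ ⟨_, fun x hx => ?_, (hext.value_le hcost hc.le _).trans
        (ENNReal.ofReal_le_ofReal ?_)⟩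
  · have hx' : x = Fin.last n := by
      by_contra hne
      have h1 : (x : ℕ) < n := by
        have := Fin.val_ne_of_ne hne
        have := x.2
        simp only [Fin.val_last] at *
        omega
      exact hx ⟨hnode x h1, Fin.lt_def.2 (by simpa using h1)⟩
    subst hx'
    rw [Function.update_of_ne (Ne.symm hw.1)]
    exact hπ _ (by simpa using hwn.le)
  · rw [hs0, Function.update_of_ne]
    · refine le_trans (mul_le_mul_of_nonneg_left ?_ hc.le) hwL
      linarith
    · intro h
      have := congrArg Fin.val h
      simp only [Fin.val_zero, Fin.val_last] at this
      omega

/-! ### Base and planted instances: value gap and divergence -/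

variable {n b : ℕ}

open Classical in
/-- Success probabilities for which, through every arm, the goal is reached in `Λ * (1 + 3 * ε)`
expected steps. -/
def baseProb (Λ ε : ℝ) (z : Fin (n + 1) × Fin (b + 1)) : unitInterval :=
  if IsArm z then Set.projIcc 0 1 zero_le_one (Λ * (1 + 3 * ε) - depth b z.1)⁻¹ else 1

/-- The success probabilities `baseProb`, except that through the arm `w` the goal is reached in `Λ`
expected steps. -/
def plantedProb (Λ ε : ℝ) (w z : Fin (n + 1) × Fin (b + 1)) : unitInterval :=
  if z = w then Set.projIcc 0 1 zero_le_one (Λ - depth b w.1)⁻¹ else baseProb Λ ε z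

lemma baseProb_of_not_isArm {Λ ε : ℝ} {z : Fin (n + 1) × Fin (b + 1)} (hz : ¬ IsArm z) :
    baseProb Λ ε z = 1 := if_neg hz

lemma plantedProb_of_ne {Λ ε : ℝ} {w z : Fin (n + 1) × Fin (b + 1)} (h : z ≠ w) :
    plantedProb Λ ε w z = baseProb Λ ε z := if_neg h

lemma plantedProb_of_not_isArm {Λ ε : ℝ} {w z : Fin (n + 1) × Fin (b + 1)} (hw : IsArm w)
    (hz : ¬ IsArm z) : plantedProb Λ ε w z = 1 := by
  rw [plantedProb_of_ne (by rintro rfl; exact hz hw), baseProb_of_not_isArm hz]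

lemma val_lt_of_ne_last {x : Fin (n + 1)} (hx : x ≠ Fin.last n) : (x : ℕ) < n := by
  have := Fin.val_ne_of_ne hx
  have := x.2
  simp only [Fin.val_last] at *
  omega

lemma coe_projIcc_inv {x : ℝ} (hx : 1 ≤ x) :
    ((Set.projIcc (0 : ℝ) 1 zero_le_one x⁻¹ : unitInterval) : ℝ) = x⁻¹ := by
  rw [Set.projIcc_of_mem zero_le_one ⟨by positivity, inv_le_one_of_one_le₀ hx⟩]

section

variable {Λ ε : ℝ} (hΛ : 4 < Λ) (hε : 0 < ε) (hε' : ε < 1 / 4)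
  (hd : ∀ k < n, (depth b k : ℝ) ≤ Λ / 2)

include hΛ hε hd

lemma coe_baseProb {z : Fin (n + 1) × Fin (b + 1)} (hz : IsArm z) :
    (baseProb Λ ε z : ℝ) = (Λ * (1 + 3 * ε) - depth b z.1)⁻¹ := by
  rw [baseProb, if_pos hz, coe_projIcc_inv]
  have := hd _ (val_lt_of_ne_last hz.1)
  nlinarith

lemma coe_plantedProb_self {w : Fin (n + 1) × Fin (b + 1)} (hw : IsArm w) :
    (plantedProb Λ ε w w : ℝ) = (Λ - depth b w.1)⁻¹ := by
  rw [plantedProb, if_pos rfl, coe_projIcc_inv]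
  have := hd _ (val_lt_of_ne_last hw.1)
  linarith

lemma baseProb_pos (z : Fin (n + 1) × Fin (b + 1)) : 0 < (baseProb Λ ε z : ℝ) := by
  by_cases hz : IsArm z
  · rw [coe_baseProb hΛ hε hd hz]
    have := hd _ (val_lt_of_ne_last hz.1)
    exact inv_pos.2 (by nlinarith)
  · simp [baseProb_of_not_isArm hz]

lemma baseProb_lt_plantedProb {w : Fin (n + 1) × Fin (b + 1)} (hw : IsArm w) :
    (baseProb Λ ε w : ℝ) < plantedProb Λ ε w w := by
  rw [coe_baseProb hΛ hε hd hw, coe_plantedProb_self hΛ hε hd hw]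
  have := hd _ (val_lt_of_ne_last hw.1)
  refine inv_strictAnti₀ (by linarith) ?_
  nlinarith

/-- Depths are at most `Λ / 2` and `Λ > 4`. The bound keeps the failure probability away from `0`,
so that likelihood ratios are positive and the divergence is controlled. -/
lemma plantedProb_lt_half {w : Fin (n + 1) × Fin (b + 1)} (hw : IsArm w) :
    (plantedProb Λ ε w w : ℝ) < 1 / 2 := by
  rw [coe_plantedProb_self hΛ hε hd hw, one_div]
  have := hd _ (val_lt_of_ne_last hw.1)
  exact inv_strictAnti₀ (by norm_num) (by linarith)

include hε' in
/-- A Markov policy that is near-optimal when the arm `w` is planted uses the arm `w` often, even if it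
is not planted. -/
lemma exists_occ_of_value_le {c : ℝ} (hc : 0 < c) {w : Fin (n + 1) × Fin (b + 1)} (hw : IsArm w)
    {π : MarkovPolicy (Fin (n + 1)) (Fin (b + 1))}
    (hπ : (treeMDP c (plantedProb Λ ε w)).value π (Fin.last n) 0 ≤
      ENNReal.ofReal ((1 + ε) * (c * Λ))) :
    ∃ T, 1 / 4 ≤ ∑ t ∈ Finset.range T, (treeMDP c (baseProb Λ ε)).occ π (Fin.last n) 0 t w *
      baseProb Λ ε w := by
  classical
  set M := treeMDP c (plantedProb Λ ε w) with hM
  set g := Fin.last n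
  have hn : (0 : Fin (n + 1)) ≠ g := by
    intro h
    have h1 := val_lt_of_ne_last hw.1
    have := congrArg Fin.val h
    simp only [g, Fin.val_zero, Fin.val_last] at this
    omega
  set p : ℝ := Subtype.val (plantedProb Λ ε w w) with hp
  have hp' := coe_plantedProb_self hΛ hε hd hw
  have hp0 : 0 < p := (baseProb_pos hΛ hε hd w).trans (baseProb_lt_plantedProb hΛ hε hd hw)
  -- This is the expected remaining time in the base instance when heading for an arm. In the
  -- planted instance it decreases by at most `1` per step on average, except at `w`, where the arm
  -- is too good by `3εΛ` with probability `p`: this is the correction `d`.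
  let ψ : Fin (n + 1) → ℝ := fun x => if x = g then 0 else Λ * (1 + 3 * ε) - depth b x
  let d : Fin (n + 1) × Fin (b + 1) → ℝ := fun z => if z = w then p * (3 * ε * Λ) else 0
  have hψ : ∀ x, x ≠ g → ψ x = Λ * (1 + 3 * ε) - depth b x := fun x hx => if_neg hx
  have hψg : ψ g = 0 := if_pos rfl
  have hψ0 : ψ 0 = Λ * (1 + 3 * ε) := by rw [hψ 0 hn]; simp [depth_zero]
  have hΛε : 0 < ε * Λ := by positivity
  have hψle : ∀ x, ψ x ≤ 2 * Λ := by
    intro x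
    by_cases hx : x = g
    · rw [hx, hψg]; linarith
    · rw [hψ x hx]
      have : (0 : ℝ) ≤ depth b x := Nat.cast_nonneg _
      nlinarith
  have hpot : ∀ z : Fin (n + 1) × Fin (b + 1), z.1 ≠ g →
      ψ z.1 ≤ 1 + ∑ x, M.P z.1 z.2 x * ψ x + d z := by
    intro z hz
    have hdz := hd _ (val_lt_of_ne_last hz)
    rw [hM, treeMDP, sum_lazyMDP_P]
    by_cases hzw : z = w
    · subst hzw
      rw [treeTarget_arm hw, hψg, show d z = p * (3 * ε * Λ) from if_pos rfl, ← hp, hψ _ hz]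
      have h1 : p * (Λ - depth b z.1) = 1 := by
        rw [hp, hp']
        exact inv_mul_cancel₀ (by linarith)
      nlinarith
    · rw [plantedProb_of_ne hzw, show d z = 0 from if_neg hzw]
      by_cases hza : IsArm z
      · rw [treeTarget_arm hza, hψg, coe_baseProb hΛ hε hd hza, ← hψ z.1 hz]
        have h0 : ψ z.1 ≠ 0 := by
          rw [hψ z.1 hz]
          nlinarith
        rw [sub_mul, inv_mul_cancel₀ h0]
        linarith
      · rw [baseProb_of_not_isArm hza]
        simp only [Set.Icc.coe_one, one_mul, sub_self, zero_mul, add_zero]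
        by_cases hr : z.2 = Fin.last b
        · rw [hr, treeTarget_reset, hψ0, hψ _ hz]
          have : (0 : ℝ) ≤ depth b z.1 := Nat.cast_nonneg _
          linarith
        · have hlt : b * (z.1 : ℕ) + z.2 + 1 < n := by
            by_contra h
            exact hza ⟨hz, hr, by omega⟩
          have ht : treeTarget z.1 z.2 = ⟨b * z.1 + z.2 + 1, by omega⟩ := by
            rw [treeTarget, if_neg (by tauto), dif_pos hlt]
          rw [ht, hψ _ hz, hψ _ (by
            intro h
            have := congrArg Fin.val h
            simp only [g, Fin.val_last] at this
            omega)]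
          simp only
          rw [depth_child (val_lt_of_ne_last hr)]
          push_cast
          linarith
  have hW : ∀ T, ∑ t ∈ Finset.range T, ∑ z, M.occ π g 0 t z ≤ (1 + ε) * Λ := by
    intro T
    have h1 := (M.value_le_iff π g 0 (c := c) (fun _ _ => rfl) hc.le (by positivity)).1 hπ T
    exact le_of_mul_le_mul_left (by linarith) hc
  have hnn : ∀ t, 0 ≤ ∑ z, M.occ π g 0 t z := fun t =>
    Finset.sum_nonneg fun z _ => M.occ_nonneg π g 0 t z
  have hsum : Summable fun t => ∑ z, M.occ π g 0 t z := summable_of_sum_range_le hnn hW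
  -- Finite expected hitting time forces the surviving mass to `0`, so the boundary term of the
  -- potential bound can be made at most `εΛ / 8`.
  obtain ⟨T, hT⟩ := (hsum.tendsto_atTop_zero.eventually
    (gt_mem_nhds (show (0 : ℝ) < ε / 16 by positivity))).exists
  refine ⟨T, ?_⟩
  have hlow := M.le_sum_occ_of_potential π g 0 hψg hpot T
  have hend : ∑ z, M.occ π g 0 T z * ψ z.1 ≤ ε / 16 * (2 * Λ) := by
    calc ∑ z, M.occ π g 0 T z * ψ z.1 ≤ ∑ z, M.occ π g 0 T z * (2 * Λ) :=
          Finset.sum_le_sum fun z _ =>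
            mul_le_mul_of_nonneg_left (hψle _) (M.occ_nonneg π g 0 T z)
      _ ≤ _ := by
        rw [← Finset.sum_mul]
        exact mul_le_mul_of_nonneg_right hT.le (by linarith)
  have hdsum : ∑ t ∈ Finset.range T, ∑ z, M.occ π g 0 t z * d z =
      (∑ t ∈ Finset.range T, M.occ π g 0 t w) * p * (3 * (ε * Λ)) := by
    rw [mul_assoc, Finset.sum_mul]
    refine Finset.sum_congr rfl fun t _ => ?_
    rw [Finset.sum_eq_single w]
    · rw [show d w = p * (3 * ε * Λ) from if_pos rfl]
      ring
    · intro z _ hz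
      rw [show d z = 0 from if_neg hz, mul_zero]
    · simp
  set K := ∑ t ∈ Finset.range T, M.occ π g 0 t w with hK
  have hK0 : 0 ≤ K := Finset.sum_nonneg fun t _ => M.occ_nonneg π g 0 t w
  -- The potential starts at `Λ + 3εΛ`, while the policy spends at most `Λ + εΛ` steps. After the
  -- boundary term `εΛ / 8`, the uses of `w` must supply the missing `15/8 * εΛ`, each contributing
  -- `3εΛp`.
  have hKp : 5 / 8 ≤ K * p := by
    rw [hdsum, hψ0] at hlow
    have := hW T
    have h2 : 15 / 8 * (ε * Λ) ≤ K * p * 3 * (ε * Λ) := by linarith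
    have := le_of_mul_le_mul_right h2 hΛε
    linarith
  -- The worst case is depth `Λ / 2` and `ε = 1/4`, where the ratio of probabilities is `(1/2) /
  -- (5/4)`. Then `5/8 * 2/5 = 1/4`.
  have hq : 2 / 5 * p ≤ baseProb Λ ε w := by
    have h1 := hd _ (val_lt_of_ne_last hw.1)
    rw [hp, hp', coe_baseProb hΛ hε hd hw, ← div_eq_mul_inv, ← one_div, div_le_div_iff₀
      (by linarith) (by nlinarith)]
    nlinarith
  -- Removing the planting makes the goal harder to enter through `w`, so more mass survives and `w`
  -- is used at least as often.
  have hmono : K ≤ ∑ t ∈ Finset.range T, (treeMDP c (baseProb Λ ε)).occ π g 0 t w := by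
    refine Finset.sum_le_sum fun t _ => MDP.occ_mono π g 0 (fun x a x' hx' => ?_) t w
    rw [hM, treeMDP, treeMDP, lazyMDP_P, lazyMDP_P]
    by_cases hz : (x, a) = w
    · have ht : treeTarget x a = g := by
        rw [← hz] at hw
        exact treeTarget_arm hw
      rw [ht, if_neg hx', mul_zero, mul_zero, zero_add, zero_add, hz]
      have := (baseProb_lt_plantedProb hΛ hε hd hw).le
      refine mul_le_mul_of_nonneg_right (by linarith) ?_
      split_ifs <;> norm_num
    · rw [plantedProb_of_ne hz]
  rw [← Finset.sum_mul]
  have h3 := mul_le_mul_of_nonneg_right hmono (baseProb_pos hΛ hε hd w).le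
  have h4 := mul_le_mul_of_nonneg_left hq hK0
  linarith

include hε' in
/-- No Markov policy is near-optimal for more than four planted arms. -/
lemma card_le_of_value_le {c : ℝ} (hc : 0 < c) {F : Finset (Fin (n + 1) × Fin (b + 1))}
    (hF : ∀ w ∈ F, IsArm w) {π : MarkovPolicy (Fin (n + 1)) (Fin (b + 1))}
    (hπ : ∀ w ∈ F, (treeMDP c (plantedProb Λ ε w)).value π (Fin.last n) 0 ≤
      ENNReal.ofReal ((1 + ε) * (c * Λ))) : F.card ≤ 4 := by
  classical
  set M := treeMDP (n := n) (b := b) c (baseProb Λ ε) with hM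
  set g := Fin.last n
  have hex : ∀ w : Fin (n + 1) × Fin (b + 1), ∃ T, w ∈ F →
      1 / 4 ≤ ∑ t ∈ Finset.range T, M.occ π g 0 t w * baseProb Λ ε w := by
    intro w
    by_cases hw : w ∈ F
    · obtain ⟨T, hT⟩ := exists_occ_of_value_le hΛ hε hε' hd hc (hF w hw) (hπ w hw)
      exact ⟨T, fun _ => hT⟩
    · exact ⟨0, fun h => absurd h hw⟩
  choose T hT using hex
  -- A common horizon for all arms in `F`. Up to it, the arms contribute disjoint parts of the
  -- probability of entering the goal, at least `1/4` each.
  set U := F.sup T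
  have hP0 : ∀ z : Fin (n + 1) × Fin (b + 1), 0 ≤ M.P z.1 z.2 g := fun z => (M.P z.1 z.2).2.1 g
  have h1 : ∀ w ∈ F, (1 / 4 : ℝ) ≤ ∑ t ∈ Finset.range U, M.occ π g 0 t w * M.P w.1 w.2 g := by
    intro w hw
    have hle : (baseProb Λ ε w : ℝ) ≤ M.P w.1 w.2 g := by
      rw [hM, treeMDP, lazyMDP_P, treeTarget_arm (hF w hw), if_pos rfl, mul_one]
      refine le_add_of_nonneg_right (mul_nonneg (sub_nonneg.2 (baseProb Λ ε w).2.2) ?_)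
      split_ifs <;> norm_num
    refine (hT w hw).trans ((Finset.sum_le_sum fun t _ => mul_le_mul_of_nonneg_left hle
      (M.occ_nonneg π g 0 t w)).trans (Finset.sum_le_sum_of_subset_of_nonneg ?_ fun t _ _ =>
        mul_nonneg (M.occ_nonneg π g 0 t w) (hP0 w)))
    exact Finset.range_mono (Finset.le_sup hw)
  have h2 : (F.card : ℝ) * (1 / 4) ≤ 1 := by
    calc (F.card : ℝ) * (1 / 4) = ∑ w ∈ F, (1 / 4 : ℝ) := by simp
      _ ≤ ∑ w ∈ F, ∑ t ∈ Finset.range U, M.occ π g 0 t w * M.P w.1 w.2 g := Finset.sum_le_sum h1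
      _ = ∑ t ∈ Finset.range U, ∑ w ∈ F, M.occ π g 0 t w * M.P w.1 w.2 g := Finset.sum_comm
      _ ≤ ∑ t ∈ Finset.range U, ∑ w, M.occ π g 0 t w * M.P w.1 w.2 g :=
        Finset.sum_le_sum fun t _ => Finset.sum_le_sum_of_subset_of_nonneg (Finset.subset_univ _)
          fun w _ _ => mul_nonneg (M.occ_nonneg π g 0 t w) (hP0 w)
      _ ≤ 1 := M.sum_occ_mul_goal_le π g 0 U
  have h3 : (F.card : ℝ) ≤ 4 := by linarith
  exact_mod_cast h3

/-- The ratio of the transition probabilities with and without the planted arm `w`. -/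
def plantedRatio (Λ ε : ℝ) (w z : Fin (n + 1) × Fin (b + 1)) (x : Fin (n + 1)) : ℝ :=
  if z = w then
    if x = Fin.last n then plantedProb Λ ε w w / baseProb Λ ε w
    else (1 - plantedProb Λ ε w w) / (1 - baseProb Λ ε w)
  else 1

lemma plantedRatio_pos {w : Fin (n + 1) × Fin (b + 1)} (hw : IsArm w)
    (z : Fin (n + 1) × Fin (b + 1)) (x : Fin (n + 1)) : 0 < plantedRatio Λ ε w z x := by
  have h1 := baseProb_pos hΛ hε hd w
  have h2 := baseProb_lt_plantedProb hΛ hε hd hw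
  have h3 := plantedProb_lt_half hΛ hε hd hw
  unfold plantedRatio
  split_ifs
  · exact div_pos (h1.trans h2) h1
  · exact div_pos (by linarith) (by linarith)
  · exact one_pos

/-- At `w` there are only two distinct outcomes, goal and staying, and both have positive
probability in the base instance, so the quotients of probabilities form a density. -/
lemma treeMDP_P_planted {c : ℝ} {w : Fin (n + 1) × Fin (b + 1)} (hw : IsArm w) (x : Fin (n + 1))
    (a : Fin (b + 1)) (y : Fin (n + 1)) : (treeMDP c (plantedProb Λ ε w)).P x a y =
      plantedRatio Λ ε w (x, a) y * (treeMDP c (baseProb Λ ε)).P x a y := by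
  have h1 := baseProb_pos hΛ hε hd w
  have h2 := baseProb_lt_plantedProb hΛ hε hd hw
  have h3 := plantedProb_lt_half hΛ hε hd hw
  rw [treeMDP, treeMDP, lazyMDP_P, lazyMDP_P, plantedRatio]
  by_cases hz : (x, a) = w
  · have hw' := hw
    rw [← hz] at hw'
    have ht : treeTarget x a = Fin.last n := treeTarget_arm hw'
    have hx : x ≠ Fin.last n := hw'.1
    rw [if_pos hz, ht, hz]
    by_cases hy : y = Fin.last n
    · subst hy
      simp only [if_true, Ne.symm hx, if_false, mul_one, mul_zero, add_zero]
      rw [div_mul_cancel₀ _ h1.ne']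
    · simp only [hy, if_false, mul_zero, zero_add]
      rw [← mul_assoc, div_mul_cancel₀ _ (by linarith)]
  · rw [if_neg hz, one_mul, plantedProb_of_ne hz]

include hε' in
/-- The divergence between the transition probabilities without and with the planted arm. -/
lemma sum_log_plantedRatio_le {c : ℝ} {w : Fin (n + 1) × Fin (b + 1)} (hw : IsArm w) :
    ∑ x, (treeMDP c (baseProb Λ ε)).P w.1 w.2 x * -Real.log (plantedRatio Λ ε w w x) ≤
      144 * ε ^ 2 / Λ := by
  have h1 := baseProb_pos hΛ hε hd w
  have h2 := baseProb_lt_plantedProb hΛ hε hd hw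
  have h3 := plantedProb_lt_half hΛ hε hd hw
  have hq := coe_baseProb hΛ hε hd hw
  have hp := coe_plantedProb_self hΛ hε hd hw
  have hdw := hd _ (val_lt_of_ne_last hw.1)
  rw [treeMDP, sum_lazyMDP_P, treeTarget_arm hw, plantedRatio, if_pos rfl, if_pos rfl,
    plantedRatio, if_pos rfl, if_neg hw.1]
  set p : ℝ := Subtype.val (plantedProb Λ ε w w)
  set q : ℝ := Subtype.val (baseProb Λ ε w)
  have hp0 : 0 < p := h1.trans h2
  have hlog : ∀ {x y : ℝ}, 0 < x → 0 < y → -Real.log (y / x) ≤ x / y - 1 := by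
    intro x y hx hy
    rw [← Real.log_inv, inv_div]
    exact Real.log_le_sub_one_of_pos (div_pos hx hy)
  have hA := mul_le_mul_of_nonneg_left (hlog h1 hp0) h1.le
  have hB := mul_le_mul_of_nonneg_left (hlog (x := 1 - q) (y := 1 - p) (by linarith)
    (by linarith)) (show 0 ≤ 1 - q by linarith)
  -- Bounding each logarithm linearly replaces the divergence by the chi-square distance of two
  -- Bernoulli laws.
  have hC : q * (q / p - 1) + (1 - q) * ((1 - q) / (1 - p) - 1) =
      (p - q) ^ 2 / (p * (1 - p)) := by
    have : 1 - p ≠ 0 := by linarith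
    field_simp
    ring
  have hpD : p * (Λ - depth b w.1) = 1 := by
    rw [hp]; exact inv_mul_cancel₀ (by linarith)
  have hqD : q * (Λ * (1 + 3 * ε) - depth b w.1) = 1 := by
    rw [hq]; exact inv_mul_cancel₀ (by nlinarith)
  -- The reciprocals of `q` and `p` differ by exactly `3εΛ`.
  have hdiff : p - q = p * q * (3 * ε * Λ) := by
    linear_combination q * hpD - p * hqD
  have hpΛ : p * Λ ≤ 2 := by nlinarith
  have hqΛ : q * Λ ≤ 2 := by nlinarith
  have hdiff' : p - q ≤ 6 * ε * p := by
    rw [hdiff]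
    have : 0 < p * ε := by positivity
    nlinarith
  have hD : (p - q) ^ 2 / (p * (1 - p)) ≤ 144 * ε ^ 2 / Λ := by
    rw [div_le_div_iff₀ (mul_pos hp0 (by linarith)) (by linarith)]
    have h5 : (p - q) ^ 2 ≤ (6 * ε * p) ^ 2 := by
      refine pow_le_pow_left₀ (by linarith) hdiff' 2
    calc (p - q) ^ 2 * Λ ≤ (6 * ε * p) ^ 2 * Λ := mul_le_mul_of_nonneg_right h5 (by linarith)
      _ = 36 * ε ^ 2 * p * (p * Λ) := by ring
      _ ≤ 36 * ε ^ 2 * p * 2 := mul_le_mul_of_nonneg_left hpΛ (by positivity)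
      _ = 144 * ε ^ 2 * (p * (1 / 2)) := by ring
      _ ≤ 144 * ε ^ 2 * (p * (1 - p)) := mul_le_mul_of_nonneg_left
        (mul_le_mul_of_nonneg_left (by linarith) hp0.le) (by positivity)
  linarith

end

open Classical in
/-- There are at least `n * (b - 1) + 1` arms. -/
lemma le_card_arms (hn : 0 < n) (hb : 0 < b) : n * b + 1 ≤
    (Finset.univ.filter fun z : Fin (n + 1) × Fin (b + 1) => IsArm z).card + n := by
  set T := Finset.univ.filter fun z : Fin (n + 1) × Fin (b + 1) =>
    z.1 ≠ Fin.last n ∧ z.2 ≠ Fin.last b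
  set C := T.filter fun z : Fin (n + 1) × Fin (b + 1) => ¬ n ≤ b * z.1 + z.2 + 1
  have hT : T.card = n * b := by
    have : T = (Finset.univ.erase (Fin.last n)) ×ˢ (Finset.univ.erase (Fin.last b)) := by
      ext z; simp [T]
    rw [this, Finset.card_product, Finset.card_erase_of_mem (Finset.mem_univ _),
      Finset.card_erase_of_mem (Finset.mem_univ _)]
    simp
  have hA : (Finset.univ.filter fun z : Fin (n + 1) × Fin (b + 1) => IsArm z) =
      T.filter fun z : Fin (n + 1) × Fin (b + 1) => n ≤ b * z.1 + z.2 + 1 := by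
    ext z
    rw [Finset.mem_filter, Finset.mem_filter, Finset.mem_filter, IsArm]
    tauto
  -- Slots that do have a child correspond injectively to non-root nodes, of which there are `n -
  -- 1`.
  have hC : C.card ≤ n - 1 := by
    rw [← Finset.card_range (n - 1)]
    refine Finset.card_le_card_of_injOn (fun z => b * (z.1 : ℕ) + z.2) ?_ ?_
    · intro z hz
      simp only [C, Finset.coe_filter, Set.mem_ofPred_eq] at hz
      simp only [Finset.coe_range, Set.mem_Iio]
      omega
    · rintro z hz z' hz' h
      have hz2 : (z.2 : ℕ) < b := by
        simp only [C, T, Finset.coe_filter, Set.mem_ofPred_eq, Finset.mem_filter] at hz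
        exact val_lt_of_ne_last hz.1.2.2
      have hz2' : (z'.2 : ℕ) < b := by
        simp only [C, T, Finset.coe_filter, Set.mem_ofPred_eq, Finset.mem_filter] at hz'
        exact val_lt_of_ne_last hz'.1.2.2
      simp only at h
      have e1 : (b * (z.1 : ℕ) + z.2) / b = z.1 := by
        rw [Nat.mul_add_div hb, Nat.div_eq_of_lt hz2, add_zero]
      have e2 : (b * (z'.1 : ℕ) + z'.2) / b = z'.1 := by
        rw [Nat.mul_add_div hb, Nat.div_eq_of_lt hz2', add_zero]
      have e3 : (z.1 : ℕ) = z'.1 := by rw [← e1, h, e2]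
      refine Prod.ext (Fin.ext e3) (Fin.ext ?_)
      rw [e3] at h
      omega
  have hsum := Finset.card_filter_add_card_filter_not (s := T)
    (fun z : Fin (n + 1) × Fin (b + 1) => n ≤ b * z.1 + z.2 + 1)
  rw [hA]
  have : C.card = (T.filter fun z : Fin (n + 1) × Fin (b + 1) =>
    ¬ n ≤ b * z.1 + z.2 + 1).card := rfl
  omega

/-! ### Algorithms as stopped processes -/

namespace Algorithm

section

variable {S A : Type} [Fintype S] [Fintype A] [MeasurableSpace S] [MeasurableSpace A]
  [DiscreteMeasurableSpace S] [DiscreteMeasurableSpace A] (𝔞 : Algorithm S A)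

/-- The trajectories along which the algorithm has not stopped up to time `k`. -/
def running (k : ℕ) : Set (ℕ → Step S A) := {ω | ∀ i ≤ k, histOf i ω ∉ 𝔞.halts i}

/-- Steps are counted from `0`, so not having stopped up to time `k` means that step `k` is taken.
Summing the probabilities of these events over `k` therefore counts steps. -/
lemma lt_τ_iff (k : ℕ) (ω : ℕ → Step S A) : (k : ℕ∞) < 𝔞.τ ω ↔ ω ∈ 𝔞.running k := by
  rw [← ENat.add_one_le_iff (ENat.natCast_ne_top k), τ, le_iInf₂_iff]
  constructor
  · intro h i hi hω
    have := h i hω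
    norm_cast at this
    omega
  · intro h i hi
    have : ¬ i ≤ k := fun hik => h i hik hi
    norm_cast
    omega

lemma antitone_running : Antitone 𝔞.running :=
  fun _ _ hij _ hω i hi => hω i (hi.trans hij)

lemma measurableSet_running (k : ℕ) : MeasurableSet (𝔞.running k) := by
  have : 𝔞.running k = ⋂ i, ⋂ (_ : i ≤ k), (histOf i ⁻¹' 𝔞.halts i)ᶜ := by
    ext; simp [running]
  rw [this]
  exact MeasurableSet.iInter fun i => MeasurableSet.iInter fun _ =>
    (measurable_histOf i (𝔞.measurableSet_halts i)).compl

lemma dependsOn_running (k : ℕ) : DependsOn (fun ω => ω ∈ 𝔞.running k) (Set.Iic k) := by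
  intro ω ω' h
  refine propext (forall₂_congr fun i hi => ?_)
  rw [histOf_dependsOn i fun j hj => h j (le_trans hj hi)]

lemma mem_stopSet_of_τ_eq {t : ℕ} {ω : ℕ → Step S A} (h : 𝔞.τ ω = t) :
    ω ∈ MDP.stopSet 𝔞.running t := by
  refine ⟨fun i hi => ?_, fun hn => ?_⟩
  · rw [← lt_τ_iff, h]
    exact_mod_cast hi
  · rw [← lt_τ_iff, h] at hn
    exact lt_irrefl _ hn

lemma stopSet_unique {N : ℕ → Set (ℕ → Step S A)} {t t' : ℕ} {ω : ℕ → Step S A}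
    (h : ω ∈ MDP.stopSet N t) (h' : ω ∈ MDP.stopSet N t') : t = t' := by
  rcases lt_trichotomy t t' with hlt | rfl | hlt
  · exact absurd (h'.1 _ hlt) h.2
  · rfl
  · exact absurd (h.1 _ hlt) h'.2

lemma sum_running_le_expectedTime (M : MDP S A) (T : ℕ) :
    ∑ k ∈ Finset.range T, M.law 𝔞.policy M.s₀ (𝔞.running k) ≤ 𝔞.expectedTime M := by
  simp only [← lintegral_indicator_one (𝔞.measurableSet_running _)]
  rw [← lintegral_finsetSum _ fun k _ => measurable_one.indicator (𝔞.measurableSet_running k)]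
  refine lintegral_mono fun ω => ?_
  classical
  simp only [Set.indicator_apply, ← lt_τ_iff, Pi.one_apply, Finset.sum_boole]
  cases h : 𝔞.τ ω using ENat.recTopCoe with
  | top => simp
  | coe m =>
    have : (Finset.range T).filter (fun k : ℕ => (k : ℕ∞) < m) ⊆ Finset.range m := by
      intro k hk
      simpa using (Finset.mem_filter.1 hk).2
    have := Finset.card_le_card this
    rw [Finset.card_range] at this
    simpa using this

lemma sum_running_le_expectedCost (M : MDP S A) {c : ℝ}
    (hc : ∀ s a, M.cost s a = Measure.dirac c) (T : ℕ) :
    ENNReal.ofReal c * ∑ k ∈ Finset.range T, M.law 𝔞.policy M.s₀ (𝔞.running k) ≤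
      𝔞.expectedCost M := by
  simp only [← lintegral_indicator_one (𝔞.measurableSet_running _)]
  have hm : ∀ k, Measurable ((𝔞.running k).indicator (1 : (ℕ → Step S A) → ℝ≥0∞)) := fun k =>
    measurable_one.indicator (𝔞.measurableSet_running k)
  rw [← lintegral_finsetSum _ fun k _ => hm k,
    ← lintegral_const_mul _ (Finset.measurable_sum _ fun k _ => hm k)]
  refine lintegral_mono_ae ?_
  filter_upwards [M.ae_cost_eq 𝔞.policy hc M.s₀] with ω hω
  rw [Finset.mul_sum]
  refine le_trans (Finset.sum_le_sum fun k _ => ?_) (ENNReal.sum_le_tsum (Finset.range T))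
  rw [hω]
  by_cases h : (k : ℕ∞) < 𝔞.τ ω
  · rw [if_pos h, Set.indicator_of_mem ((𝔞.lt_τ_iff k ω).1 h), Pi.one_apply, mul_one]
  · rw [if_neg h, Set.indicator_of_notMem (fun h' => h ((𝔞.lt_τ_iff k ω).2 h')), mul_zero]

/-- The algorithm stops with an output policy for `g` whose value on `M` is at most `v`. -/
def success (M : MDP S A) (g : S) (v : ℝ≥0∞) : Set (ℕ → Step S A) :=
  ⋃ t, MDP.stopSet 𝔞.running t ∩ {ω | M.value (𝔞.output t (histOf t ω) g) g M.s₀ ≤ v}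

lemma measurableSet_success (M : MDP S A) {c : ℝ} (hc : ∀ s a, M.cost s a = Measure.dirac c) (g : S)
    (v : ℝ≥0∞) : MeasurableSet (𝔞.success M g v) := by
  refine MeasurableSet.iUnion fun t => (MDP.measurableSet_stopSet 𝔞.measurableSet_running t).inter ?_
  have h1 : Measurable fun ω : ℕ → Step S A => M.value (𝔞.output t (histOf t ω) g) g M.s₀ :=
    (M.measurable_value g M.s₀ hc).comp
      ((measurable_pi_apply g).comp ((𝔞.measurable_output t).comp (measurable_histOf t)))
  exact measurableSet_le h1 measurable_const

/-- The stopping time is unique, so the union over `t` defining success collapses to the time at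
which the trajectory stops. -/
lemma mem_success_iff (M : MDP S A) (g : S) (v : ℝ≥0∞) {t : ℕ} {ω : ℕ → Step S A}
    (h : ω ∈ MDP.stopSet 𝔞.running t) :
    ω ∈ 𝔞.success M g v ↔ M.value (𝔞.output t (histOf t ω) g) g M.s₀ ≤ v := by
  rw [success, Set.mem_iUnion]
  constructor
  · rintro ⟨t', h1, h2⟩
    obtain rfl := stopSet_unique h h1
    exact h2
  · exact fun h' => ⟨t, h, h'⟩

lemma IsPAC.le_success {𝔞 : Algorithm S A} {M : MDP S A} {ε δ L : ℝ} (h : 𝔞.IsPAC M ε δ L) {g : S}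
    (hg : g ∈ M.controllable L) : ENNReal.ofReal (1 - δ) ≤
      M.law 𝔞.policy M.s₀ (𝔞.success M g (ENNReal.ofReal ((1 + ε) * L))) := by
  refine h.trans (measure_mono ?_)
  rintro ω ⟨t, ht, -, hout⟩
  exact (mem_success_iff _ _ _ _ (𝔞.mem_stopSet_of_τ_eq ht)).2 (hout g hg)

end

/-! ### Summing the testing bounds over all arms -/

section

variable {n b : ℕ}

open Classical in
/-- Lower bound on the number of steps on the tree without a planted arm. -/
lemma exists_le_sum_running (𝔞 : Algorithm (Fin (n + 1)) (Fin (b + 1))) {c L ε δ : ℝ} (hc : 0 < c)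
    (hL : 4 < L / c) (hε : 0 < ε) (hε' : ε < 1 / 4) (hδ : 0 < δ) (hδ' : δ < 1 / 16)
    (hb : 0 < b) (hd : ∀ k < n, (depth b k : ℝ) ≤ L / c / 2)
    (hpac : ∀ w, IsArm w → 𝔞.IsPAC (treeMDP c (plantedProb (L / c) ε w)) ε δ L)
    (B : ℝ) (hB : B * (1152 * ε ^ 2 / (L / c)) ≤ ((Finset.univ.filter fun w :
      Fin (n + 1) × Fin (b + 1) => IsArm w).card - 8 : ℝ) * Real.log (1 / δ)) :
    ∃ T, B ≤ ∑ k ∈ Finset.range T,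
      ((treeMDP c (baseProb (L / c) ε)).law 𝔞.policy 0).real (𝔞.running k) := by
  set M := treeMDP (n := n) (b := b) c (baseProb (L / c) ε) with hM
  set μ := M.law 𝔞.policy 0 with hμ
  set Λ := L / c with hΛ
  have hcL : c * Λ = L := by rw [hΛ]; field_simp
  have hΛ0 : 0 < Λ := by linarith
  -- `hpac` concerns the planted instances only, so the algorithm may run forever in the base
  -- instance. If it does so with positive probability, the partial sums are unbounded and any `B`
  -- is exceeded.
  by_cases hnull : μ (⋂ k, 𝔞.running k) = 0
  swap
  · have hp : 0 < μ.real (⋂ k, 𝔞.running k) :=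
      ENNReal.toReal_pos hnull (measure_ne_top _ _)
    obtain ⟨T, hT⟩ := exists_nat_ge (B / μ.real (⋂ k, 𝔞.running k))
    refine ⟨T, ((div_le_iff₀ hp).1 hT).trans ?_⟩
    calc (T : ℝ) * μ.real (⋂ k, 𝔞.running k)
        = ∑ _k ∈ Finset.range T, μ.real (⋂ k, 𝔞.running k) := by simp
      _ ≤ _ := Finset.sum_le_sum fun k _ => measureReal_mono (Set.iInter_subset _ k)
  have hcost : ∀ q : Fin (n + 1) × Fin (b + 1) → unitInterval, ∀ s a,
      (treeMDP c q).cost s a = Measure.dirac c := fun _ _ _ => rfl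
  set v := ENNReal.ofReal ((1 + ε) * L) with hv
  set E : Fin (n + 1) × Fin (b + 1) → Set (ℕ → Step (Fin (n + 1)) (Fin (b + 1))) := fun w =>
    𝔞.success (treeMDP c (plantedProb Λ ε w)) (Fin.last n) v with hE
  have hEm : ∀ w, MeasurableSet (E w) := fun w =>
    𝔞.measurableSet_success _ (hcost _) (Fin.last n) v
  set arms := Finset.univ.filter fun w : Fin (n + 1) × Fin (b + 1) => IsArm w with harms
  -- Pointwise, the single policy output along a trajectory is near-optimal for at most four
  -- plantings. Integrating gives the bound on the sum.
  have hsumE : ∑ w ∈ arms, μ.real (E w) ≤ 4 := by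
    have h1 : ∑ w ∈ arms, μ (E w) ≤ 4 := by
      simp only [← lintegral_indicator_one (hEm _)]
      rw [← lintegral_finsetSum _ fun w _ => measurable_one.indicator (hEm w)]
      refine (lintegral_mono (g := fun _ => 4) fun ω => ?_).trans (by simp)
      simp only [Set.indicator_apply, Pi.one_apply, Finset.sum_boole]
      suffices h : (arms.filter fun w => ω ∈ E w).card ≤ 4 by exact_mod_cast h
      by_cases hω : ∃ t, ω ∈ MDP.stopSet 𝔞.running t
      · obtain ⟨t, ht⟩ := hω
        refine card_le_of_value_le (Λ := Λ) (ε := ε) hL hε hε' hd hc (fun w hw => ?_)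
          (π := 𝔞.output t (histOf t ω) (Fin.last n)) (fun w hw => ?_)
        · exact (Finset.mem_filter.1 (Finset.mem_filter.1 hw).1).2
        · rw [hcL]
          exact (mem_success_iff _ _ _ _ ht).1 (Finset.mem_filter.1 hw).2
      · rw [Finset.filter_eq_empty_iff.2]
        · simp
        · intro w _ hw
          obtain ⟨t, ht, -⟩ := Set.mem_iUnion.1 hw
          exact hω ⟨t, ht⟩
    have h2 := ENNReal.toReal_mono (by norm_num) h1
    rw [ENNReal.toReal_sum fun w _ => measure_ne_top _ _] at h2
    simpa [measureReal_def] using h2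
  set good := arms.filter fun w => μ.real (E w) ≤ 1 / 2 with hgood
  -- By Markov's inequality at most 8 arms have success probability above `1/2`.
  have hcard : (arms.card : ℝ) - 8 ≤ good.card := by
    have h1 : (arms.filter fun w => ¬ μ.real (E w) ≤ 1 / 2).card * (1 / 2 : ℝ) ≤ 4 := by
      refine le_trans ?_ hsumE
      rw [← nsmul_eq_mul, ← Finset.sum_const]
      refine (Finset.sum_le_sum (g := fun w => μ.real (E w)) fun w hw => ?_).trans
        (Finset.sum_le_sum_of_subset_of_nonneg (Finset.filter_subset _ _)
          fun _ _ _ => measureReal_nonneg)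
      exact (not_le.1 (Finset.mem_filter.1 hw).2).le
    have h2 := Finset.card_filter_add_card_filter_not (s := arms) (fun w => μ.real (E w) ≤ 1 / 2)
    have h3 : (arms.card : ℝ) = good.card +
        (arms.filter fun w => ¬ μ.real (E w) ≤ 1 / 2).card := by
      rw [← h2]; push_cast; rfl
    linarith
  have hlogδ : 0 ≤ Real.log (1 / δ) := Real.log_nonneg (by
    rw [le_div_iff₀ hδ]; linarith)
  have hkey : ∀ w, ∃ T, w ∈ good → Real.log (1 / δ) / 8 ≤ 144 * ε ^ 2 / Λ *
      ∑ k ∈ Finset.range T, μ.real (𝔞.running k ∩ MDP.visits w k) := by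
    intro w
    by_cases hw : w ∈ good
    swap
    · exact ⟨0, fun h => absurd h hw⟩
    have hwa : IsArm w := (Finset.mem_filter.1 (Finset.mem_filter.1 hw).1).2
    have hwE : μ.real (E w) ≤ 1 / 2 := (Finset.mem_filter.1 hw).2
    have hfin : MeasurableSet (⋂ k, 𝔞.running k) :=
      MeasurableSet.iInter fun k => 𝔞.measurableSet_running k
    have hctrl : Fin.last n ∈ (treeMDP c (plantedProb Λ ε w)).controllable L := by
      have hp := coe_plantedProb_self hL hε hd hwa
      have hdw := hd _ (val_lt_of_ne_last hwa.1)
      refine last_mem_controllable hc (fun z hz => plantedProb_of_not_isArm hwa hz) hb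
        (fun k hk => ?_) hwa ?_ ?_
      · rw [← hcL]
        exact mul_le_mul_of_nonneg_left ((hd k hk).trans (by linarith)) hc.le
      · rw [hp]; exact inv_pos.2 (by linarith)
      · rw [hp, one_div, inv_inv, ← hcL]
        exact le_of_eq (by ring)
    have hpacw := (hpac w hwa).le_success hctrl
    -- The test event is that the algorithm stops with an output that fails for the planting at `w`.
    -- Under the base law stopping is almost sure (`hnull`), so its probability is at least `1/2`.
    refine (MDP.log_le_sum_visits (M := M) (M' := treeMDP c (plantedProb Λ ε w))
      (R := plantedRatio Λ ε w) 𝔞.policy 0 (N := 𝔞.running) (z := w)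
      (plantedRatio_pos hL hε hd hwa) (fun z hz x => if_neg hz) (fun _ _ => rfl)
      (treeMDP_P_planted hL hε hd hwa) 𝔞.measurableSet_running 𝔞.antitone_running
      𝔞.dependsOn_running (B := (E w)ᶜ ∩ (⋂ k, 𝔞.running k)ᶜ)
      ((hEm w).compl.inter hfin.compl) ?_ ?_ (sum_log_plantedRatio_le hL hε hε' hd hwa) hδ hδ'.le
      ?_ ?_).imp fun T hT _ => hT
    · intro t ω ω' h
      have h1 : ∀ ω, (ω ∈ ((E w)ᶜ ∩ (⋂ k, 𝔞.running k)ᶜ) ∩ MDP.stopSet 𝔞.running t) =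
          (ω ∈ MDP.stopSet 𝔞.running t ∧ ¬ (treeMDP c (plantedProb Λ ε w)).value
            (𝔞.output t (histOf t ω) (Fin.last n)) (Fin.last n) 0 ≤ v) := by
        intro ω
        refine propext ⟨fun h => ⟨h.2, fun hv => h.1.1 ?_⟩, fun h => ⟨⟨fun hw => h.2 ?_, ?_⟩, h.1⟩⟩
        · exact (mem_success_iff _ _ _ _ h.2).2 hv
        · exact (mem_success_iff _ _ _ _ h.1).1 hw
        · exact fun hall => h.1.2 (Set.mem_iInter.1 hall t)
      simp only [h1]
      rw [show (ω ∈ MDP.stopSet 𝔞.running t) = (ω' ∈ MDP.stopSet 𝔞.running t) from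
        MDP.dependsOn_stopSet 𝔞.dependsOn_running t h, histOf_dependsOn t h]
    · rintro ω ⟨-, hω⟩
      simpa using hω
    · have h1 : μ.real ((E w)ᶜ ∩ (⋂ k, 𝔞.running k)ᶜ) = μ.real (E w)ᶜ := by
        rw [measureReal_def, measureReal_def, ← Set.sdiff_eq, measure_sdiff_null hnull]
      rw [h1, probReal_compl_eq_one_sub (hEm w)]
      linarith
    · refine (measure_mono Set.inter_subset_left).trans ?_
      rw [prob_compl_eq_one_sub (hEm w)]
      refine (tsub_le_tsub_left hpacw 1).trans ?_
      rw [← ENNReal.ofReal_one, ← ENNReal.ofReal_sub _ (by linarith)]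
      exact ENNReal.ofReal_le_ofReal (by linarith)
  choose T hT using hkey
  refine ⟨good.sup T, ?_⟩
  set U := good.sup T
  have hκ : 0 < 144 * ε ^ 2 / Λ := by positivity
  have h1 : good.card * (Real.log (1 / δ) / 8) ≤
      144 * ε ^ 2 / Λ * ∑ k ∈ Finset.range U, μ.real (𝔞.running k) := by
    calc good.card * (Real.log (1 / δ) / 8) = ∑ w ∈ good, Real.log (1 / δ) / 8 := by simp
      _ ≤ ∑ w ∈ good, 144 * ε ^ 2 / Λ *
          ∑ k ∈ Finset.range U, μ.real (𝔞.running k ∩ MDP.visits w k) := by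
        refine Finset.sum_le_sum fun w hw => (hT w hw).trans
          (mul_le_mul_of_nonneg_left ?_ hκ.le)
        exact Finset.sum_le_sum_of_subset_of_nonneg
          (Finset.range_mono (Finset.le_sup hw)) fun _ _ _ => measureReal_nonneg
      _ = 144 * ε ^ 2 / Λ *
          ∑ k ∈ Finset.range U, ∑ w ∈ good, μ.real (𝔞.running k ∩ MDP.visits w k) := by
        rw [← Finset.mul_sum, Finset.sum_comm]
      _ ≤ _ := by
        refine mul_le_mul_of_nonneg_left (Finset.sum_le_sum fun k _ => ?_) hκ.le
        -- At any given time only one state-action pair is visited, so the events for different arms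
        -- are disjoint.
        rw [← measureReal_biUnion_finset]
        · exact measureReal_mono (Set.iUnion₂_subset fun w _ => Set.inter_subset_left)
        · intro w _ w' _ hne
          refine Set.disjoint_left.2 fun ω h h' => hne ?_
          exact (show _ = w from h.2).symm.trans h'.2
        · exact fun w _ => (𝔞.measurableSet_running k).inter (MDP.measurableSet_visits w k)
  have h2 : B * (1152 * ε ^ 2 / Λ) ≤
      (∑ k ∈ Finset.range U, μ.real (𝔞.running k)) * (1152 * ε ^ 2 / Λ) := by
    refine hB.trans ((mul_le_mul_of_nonneg_right hcard hlogδ).trans ?_)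
    have h3 : 1152 * ε ^ 2 / Λ = 8 * (144 * ε ^ 2 / Λ) := by ring
    rw [h3]
    linarith
  exact le_of_mul_le_mul_right h2 (by positivity)

end

end Algorithm

end AX

end

/-! ### Choice of parameters and conclusion -/

/-- Minimax lower bound for autonomous exploration. An algorithm is a family indexed by what the
learner knows about the MDP: its state space, its action space, its initial state and which action
is RESET. -/
theorem theorem3 :
    ∃ C : ℝ, 0 < C ∧
      ∀ (L ε δ cmin : ℝ) (S A SL : ℕ),
        4 < L → 8 < S → 4 < A → 4 ≤ SL → SL ≤ min ((A - 1) ^ ⌊L / 2⌋₊) S →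
        0 < ε → ε < 1 / 4 → 0 < δ → δ < 1 / 16 → 0 < cmin → cmin ≤ 1 →
        ∀ alg : (n m : ℕ) → Fin n → Fin m → Algorithm (Fin n) (Fin m),
          (∀ (n m : ℕ) (M : MDP (Fin n) (Fin m)), M.InClass S A cmin L SL →
            (alg n m M.s₀ M.reset).IsPAC M ε δ L) →
          ∃ (n m : ℕ) (M : MDP (Fin n) (Fin m)), M.InClass S A cmin L SL ∧
            ENNReal.ofReal (C * (L * SL * A / (cmin * ε ^ 2) * Real.log (1 / δ))) ≤
              (alg n m M.s₀ M.reset).expectedTime M ∧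
            ENNReal.ofReal (C * (L * SL * A * (ε ^ 2)⁻¹ * Real.log (1 / δ))) ≤
              (alg n m M.s₀ M.reset).expectedCost M := by
  refine ⟨1 / 20000, by norm_num, ?_⟩
  intro L ε δ c S A SL hL _ hA hSL4 hSL hε hε' hδ hδ' hc hc1 alg halg
  obtain ⟨n, rfl⟩ : ∃ n, SL = n + 1 := ⟨SL - 1, by omega⟩
  obtain ⟨b, rfl⟩ : ∃ b, A = b + 1 := ⟨A - 1, by omega⟩
  rw [le_min_iff, Nat.add_sub_cancel] at hSL
  have hLc : L ≤ L / c := le_div_self (by linarith) hc hc1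
  -- This is where the restriction on `SL` enters: `n` nodes fit into depth `⌊L / 2⌋`, and `L ≤ L /
  -- c` because `c ≤ 1`.
  have hd : ∀ k < n, (depth b k : ℝ) ≤ L / c / 2 := by
    intro k hk
    have h1 : depth b k ≤ ⌊L / 2⌋₊ := depth_le _ _ (by omega)
    have h2 : (depth b k : ℝ) ≤ (⌊L / 2⌋₊ : ℝ) := by exact_mod_cast h1
    have h3 := Nat.floor_le (show 0 ≤ L / 2 by linarith)
    linarith
  set M := treeMDP (n := n) (b := b) c (baseProb (L / c) ε) with hM
  have hclass : M.InClass S (b + 1) c L (n + 1) :=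
    inClass_treeMDP hc1 (fun z hz => baseProb_of_not_isArm hz) hSL.2 L
  set 𝔞 := alg (n + 1) (b + 1) M.s₀ M.reset with h𝔞
  have hlog : 0 ≤ Real.log (1 / δ) := Real.log_nonneg (by
    rw [le_div_iff₀ hδ]; linarith)
  set B : ℝ := 1 / 20000 * (L * (n + 1 : ℕ) * (b + 1 : ℕ) / (c * ε ^ 2) * Real.log (1 / δ))
    with hB
  -- Base and planted instances share state space, actions, initial state and RESET, so the learner
  -- runs the same algorithm `𝔞` on all of them.
  obtain ⟨T, hT⟩ := 𝔞.exists_le_sum_running (δ := δ) hc (by linarith) hε hε' hδ hδ' (by omega) hd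
    (fun w hw => halg (n + 1) (b + 1) _ (inClass_treeMDP hc1
      (fun z hz => plantedProb_of_not_isArm hw hz) hSL.2 L)) B (by
      classical
      have h1 := le_card_arms (n := n) (b := b) (by omega) (by omega)
      have h2 : B * (1152 * ε ^ 2 / (L / c)) =
          1152 / 20000 * ((n + 1) * (b + 1)) * Real.log (1 / δ) := by
        rw [hB]
        have : L ≠ 0 := by linarith
        push_cast
        field_simp
      rw [h2]
      -- It remains to compare `1152 / 20000 * (n + 1) * (b + 1)` with the number of arms minus 8,
      -- which is at least `n * b - n - 7`. The case `n = 3`, `b = 4` leaves `2` on the right, which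
      -- is still enough.
      refine mul_le_mul_of_nonneg_right ?_ hlog
      have h3 : (n * b + 1 : ℝ) ≤ (Finset.univ.filter fun z : Fin (n + 1) × Fin (b + 1) =>
        IsArm z).card + n := by exact_mod_cast h1
      have hn' : (3 : ℝ) ≤ n := by exact_mod_cast (show 3 ≤ n by omega)
      have hb' : (4 : ℝ) ≤ b := by exact_mod_cast (show 4 ≤ b by omega)
      have h4 : 0 ≤ ((n : ℝ) - 3) * (b - 4) := mul_nonneg (by linarith) (by linarith)
      refine le_trans ?_ (sub_le_sub_right (sub_le_iff_le_add.2 h3) 8)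
      nlinarith)
  have hsum : ENNReal.ofReal B ≤
      ∑ k ∈ Finset.range T, M.law 𝔞.policy M.s₀ (𝔞.running k) := by
    refine (ENNReal.ofReal_le_ofReal hT).trans (le_of_eq ?_)
    rw [ENNReal.ofReal_sum_of_nonneg fun _ _ => measureReal_nonneg]
    exact Finset.sum_congr rfl fun k _ => ofReal_measureReal
  refine ⟨n + 1, b + 1, M, hclass, hsum.trans (𝔞.sum_running_le_expectedTime M T), ?_⟩
  refine le_trans ?_ (𝔞.sum_running_le_expectedCost M (c := c) (fun _ _ => rfl) T)
  refine le_trans (le_of_eq ?_) (mul_le_mul_right hsum _)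
  rw [← ENNReal.ofReal_mul hc.le, hB]
  congr 1
  field_simp
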